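/- Conventions. All algebras are over $\mathbb C$; C*-algebras need not be unital. For a C*-algebra $D$, C*-algebras $A, B$, a finite-dimensional linear subspace $E\subset A$ and a linear map $u:E\to B$, write $\|Id_D\otimes u: D\otimes_{\min}E\to D\otimes_{\max}B\|$ for the supremum of $\|(Id_D\otimes u)(t)\|_{D\otimes_{\max}B}$ over all $t$ in the algebraic tensor product $D\otimes E$ whose norm in $D\otimes_{\min}A$ is at most $1$. For a class $\mathcal D$ of C*-algebras, $mM^{\mathcal D}(E,B)$ is the space of all linear maps $u:E\to B$ with $$\|u\|_{mM^{\mathcal D}}=\sup_{D\in\mathcal D}\|Id_D\otimes u: D\otimes_{\min}E\to D\otimes_{\max}B\|.$$ Let $\mathscr C=C^*(\mathbb F_\infty)$ be the full C*-algebra of the free group on countably infinitely many generators and let $\ell_\infty(\mathscr C)$ be the C*-algebra of bounded sequences in $\mathscr C$; $mM(E,B)$ is the space of all linear maps $u:E\to B$ with $\|u\|_{mM}=\|Id\otimes u:\ell_\infty(\mathscr C)\otimes_{\min}E\to\ell_\infty(\mathscr C)\otimes_{\max}B\|$. The bidual $C^{**}$ of a C*-algebra $C$ is a C*-algebra for the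 Arens product and the bitransposed involution. Theorem. Let $E\subset A$ be a finite-dimensional subspace of a C*-algebra $A$ and let $C$ be a C*-algebra. (1) Let $\mathcal D$ be a class of C*-algebras that is stable under arbitrary $\ell_\infty$-sums, i.e. $\ell_\infty(\{D_i\}_{i\in I})\in\mathcal D$ for every non-empty family $(D_i)_{i\in I}$ in $\mathcal D$. Then every bounded functional on $mM^{\mathcal D}(E,C)$ has the form $v\mapsto\langle z,v\rangle$ for a unique $z\in E\otimes C^*$, where $\langle e\otimes\varphi,v\rangle=\varphi(v(e))$, and if $\mathcal D$ contains an algebra other than $0$ then every $z\in E\otimes C^*$ gives a bounded functional. With the duality $\langle e\otimes\varphi,w\rangle=w(e)(\varphi)$ between $E\otimes C^*$ and the linear maps $w:E\to C^{**}$, the canonical map $$mM^{\mathcal D}(E,C^{**})\to mM^{\mathcal D}(E,C)^{**}$$ is contractive. Moreover every $w:E\to C^{**}$ with $\|w\|_{mM^{\mathcal D}}\le1$ is the limit of a net $(v_i)$ of linear maps $E\to C$ with $\|v_i\|_{mM^{\mathcal D}}\le1$, in the sense that $\varphi(v_i(e))\to w(e)(\varphi)$ for all $e\in E$ and $\varphi\in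 C^*$ (pointwise weak* convergence). (2) If $C$ is separable, the same holds for the norm $\|\cdot\|_{mM}$: the bounded functionals on $mM(E,C)$ are exactly those given by the elements $z\in E\otimes C^*$ (with $z$ unique), the canonical map $mM(E,C^{**})\to mM(E,C)^{**}$ is contractive, and every $w$ in the closed unit ball of $mM(E,C^{**})$ is the pointwise weak* limit of a net in the closed unit ball of $mM(E,C)$. -/

import Mathlib

open TensorProduct Filter Topology
open scoped ENNReal NNReal

universe u

/-! ### The bidual of a C*-algebra -/

/-- The bidual `C**` of a C*-algebra `C`, a *-algebra for the Arens product and the bitransposed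
involution (this is the enveloping von Neumann algebra of `C`). -/
def Bidual (C : Type u) [NonUnitalCStarAlgebra C] : Type u :=
  StrongDual ℂ (StrongDual ℂ C)

namespace Bidual

noncomputable section

variable {C : Type u} [NonUnitalCStarAlgebra C]

instance : AddCommGroup (Bidual C) :=
  inferInstanceAs (AddCommGroup (StrongDual ℂ (StrongDual ℂ C)))

instance : Module ℂ (Bidual C) :=
  inferInstanceAs (Module ℂ (StrongDual ℂ (StrongDual ℂ C)))

/-- The evaluation pairing `C** × C* → ℂ`. -/
def eval : Bidual C →ₗ[ℂ] StrongDual ℂ C →ₗ[ℂ] ℂ :=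
  (ContinuousLinearMap.coeLM ℂ : (StrongDual ℂ C →L[ℂ] ℂ) →ₗ[ℂ] StrongDual ℂ C →ₗ[ℂ] ℂ)

theorem ext_eval {F G : Bidual C} (h : ∀ φ, eval F φ = eval G φ) : F = G :=
  ContinuousLinearMap.ext h

/-- The canonical map `C → C**`. -/
def canon : C →ₗ[ℂ] Bidual C :=
  (NormedSpace.inclusionInDoubleDual ℂ C : C →L[ℂ] StrongDual ℂ (StrongDual ℂ C)).toLinearMap

theorem eval_canon (c : C) (φ : StrongDual ℂ C) : eval (canon c) φ = φ c := rfl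

/-- For `G ∈ C**` the continuous linear map `φ ↦ G · φ` of `C*`, where
`(G · φ)(a) = G (b ↦ φ (a * b))`. -/
def act (G : Bidual C) : StrongDual ℂ C →L[ℂ] StrongDual ℂ C :=
  ContinuousLinearMap.compL ℂ C (StrongDual ℂ C) ℂ (show StrongDual ℂ C →L[ℂ] ℂ from G) ∘L
    ((ContinuousLinearMap.compL ℂ C (C →L[ℂ] C) (C →L[ℂ] ℂ)).flip (ContinuousLinearMap.mul ℂ C)) ∘L
      ContinuousLinearMap.compL ℂ C C ℂ

theorem act_apply (G : Bidual C) (φ : StrongDual ℂ C) (a : C) :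
    act G φ a = eval G (φ ∘L ContinuousLinearMap.mul ℂ C a) := rfl

/-- The (first) Arens product, `(F * G)(φ) = F (a ↦ G (b ↦ φ (a * b)))`. -/
instance : Mul (Bidual C) where
  mul F G := (show StrongDual ℂ C →L[ℂ] ℂ from F) ∘L act G

theorem eval_mul (F G : Bidual C) (φ : StrongDual ℂ C) :
    eval (F * G) φ = eval F (act G φ) := rfl

theorem act_mul (F G : Bidual C) (φ : StrongDual ℂ C) : act (F * G) φ = act F (act G φ) := by
  ext a
  rw [act_apply, act_apply, eval_mul]
  congr 1
  ext b
  rw [act_apply, ContinuousLinearMap.comp_apply, act_apply]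
  congr 1
  ext c
  simp [mul_assoc]

instance : NonUnitalRing (Bidual C) where
  left_distrib F G H := ext_eval fun φ => by
    have h : act (G + H) φ = act G φ + act H φ := by
      ext a
      simp [act_apply]
    simp [eval_mul, h]
  right_distrib F G H := ext_eval fun φ => by simp [eval_mul]
  zero_mul F := ext_eval fun φ => by simp [eval_mul]
  mul_zero F := ext_eval fun φ => by
    have h : act (0 : Bidual C) φ = 0 := by
      ext a
      simp [act_apply]
    simp [eval_mul, h]
  mul_assoc F G H := ext_eval fun φ => by simp [eval_mul, act_mul]

/-- The involution of `C*`, `φ*(a) = conj (φ (a*))`. -/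
def dualStar (φ : StrongDual ℂ C) : StrongDual ℂ C :=
  (starL ℂ : ℂ ≃L⋆[ℂ] ℂ).toContinuousLinearMap.comp
    (φ.comp (starL ℂ : C ≃L⋆[ℂ] C).toContinuousLinearMap)

theorem dualStar_apply (φ : StrongDual ℂ C) (a : C) : dualStar φ a = star (φ (star a)) := rfl

theorem norm_dualStar_le (φ : StrongDual ℂ C) : ‖dualStar φ‖ ≤ ‖φ‖ :=
  ContinuousLinearMap.opNorm_le_bound _ (norm_nonneg _) fun a => by
    rw [dualStar_apply, norm_star]
    simpa using φ.le_opNorm (star a)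

/-- The involution of `C**`, `F*(φ) = conj (F (φ*))`. -/
instance : Star (Bidual C) where
  star F := LinearMap.mkContinuous
    { toFun := fun φ => star (eval F (dualStar φ))
      map_add' := fun φ ψ => by
        have h : dualStar (φ + ψ) = dualStar φ + dualStar ψ := by
          ext a
          simp [dualStar_apply]
        simp [h]
      map_smul' := fun c φ => by
        have h : dualStar (c • φ) = star c • dualStar φ := by
          ext a
          simp [dualStar_apply]
        simp [h] }
    ‖(show StrongDual ℂ C →L[ℂ] ℂ from F)‖ fun φ => by
      have h := (show StrongDual ℂ C →L[ℂ] ℂ from F).le_opNorm (dualStar φ)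
      have h' := mul_le_mul_of_nonneg_left (norm_dualStar_le φ)
        (norm_nonneg (show StrongDual ℂ C →L[ℂ] ℂ from F))
      simp only [LinearMap.coe_mk, AddHom.coe_mk, norm_star]
      exact h.trans h'

theorem eval_star (F : Bidual C) (φ : StrongDual ℂ C) :
    eval (star F) φ = star (eval F (dualStar φ)) := rfl

theorem canon_mul (a b : C) : canon (a * b) = canon a * canon b := rfl

theorem canon_star (a : C) : canon (star a) = star (canon a) := ext_eval fun φ => by
  rw [eval_star, eval_canon, eval_canon, dualStar_apply, star_star]

end

end Bidual

/-! ### The minimal and the maximal C*-norm -/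

noncomputable section

/-- The operator `(π ⊗ ρ)(t)` on the inner product space `H ⊗ K` (it has the same norm as its
extension to the Hilbert space completion of `H ⊗ K`). -/
def tensorRep {D A H K : Type u} [NonUnitalCStarAlgebra D] [NonUnitalCStarAlgebra A]
    [NormedAddCommGroup H] [InnerProductSpace ℂ H] [CompleteSpace H]
    [NormedAddCommGroup K] [InnerProductSpace ℂ K] [CompleteSpace K]
    (π : D →⋆ₙₐ[ℂ] (H →L[ℂ] H)) (ρ : A →⋆ₙₐ[ℂ] (K →L[ℂ] K)) :
    D ⊗[ℂ] A →ₗ[ℂ] (H ⊗[ℂ] K →L[ℂ] H ⊗[ℂ] K) :=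
  TensorProduct.lift <| LinearMap.mk₂ ℂ (fun d a => TensorProduct.mapL (π d) (ρ a))
    (fun d d' a => by simp [TensorProduct.mapL_add_left])
    (fun c d a => by simp [TensorProduct.mapL_smul_left])
    (fun d a a' => by simp [TensorProduct.mapL_add_right])
    (fun c d a => by simp [TensorProduct.mapL_smul_right])

/-- The minimal (spatial) C*-norm on the algebraic tensor product of two C*-algebras: the supremum
of `‖(π ⊗ ρ)(t)‖` over all *-representations `π` and `ρ` on Hilbert spaces. -/
def minTensorNorm {D A : Type u} [NonUnitalCStarAlgebra D] [NonUnitalCStarAlgebra A]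
    (t : D ⊗[ℂ] A) : ℝ≥0∞ :=
  ⨆ (H : Type u) (_ : NormedAddCommGroup H) (_ : InnerProductSpace ℂ H) (_ : CompleteSpace H)
    (K : Type u) (_ : NormedAddCommGroup K) (_ : InnerProductSpace ℂ K) (_ : CompleteSpace K)
    (π : D →⋆ₙₐ[ℂ] (H →L[ℂ] H)) (ρ : A →⋆ₙₐ[ℂ] (K →L[ℂ] K)), ‖tensorRep π ρ t‖ₑ

/-- The operator `∑ π(d_k) σ(b_k)` for `t = ∑ d_k ⊗ b_k`. -/
def prodRep {D B H : Type u} [NonUnitalCStarAlgebra D] [NonUnitalRing B] [Module ℂ B] [Star B]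
    [NormedAddCommGroup H] [InnerProductSpace ℂ H] [CompleteSpace H]
    (π : D →⋆ₙₐ[ℂ] (H →L[ℂ] H)) (σ : B →⋆ₙₐ[ℂ] (H →L[ℂ] H)) :
    D ⊗[ℂ] B →ₗ[ℂ] (H →L[ℂ] H) :=
  LinearMap.mul' ℂ (H →L[ℂ] H) ∘ₗ
    TensorProduct.map (π : D →ₗ[ℂ] (H →L[ℂ] H)) (σ : B →ₗ[ℂ] (H →L[ℂ] H))

/-- The maximal C*-norm on the algebraic tensor product: the supremum of `‖∑ π(d_k) σ(b_k)‖` over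
all pairs of *-representations `π` and `σ` with commuting ranges on a Hilbert space. -/
def maxTensorNorm {D B : Type u} [NonUnitalCStarAlgebra D] [NonUnitalRing B] [Module ℂ B] [Star B]
    (t : D ⊗[ℂ] B) : ℝ≥0∞ :=
  ⨆ (H : Type u) (_ : NormedAddCommGroup H) (_ : InnerProductSpace ℂ H) (_ : CompleteSpace H)
    (π : D →⋆ₙₐ[ℂ] (H →L[ℂ] H)) (σ : B →⋆ₙₐ[ℂ] (H →L[ℂ] H))
    (_ : ∀ d b, Commute (π d) (σ b)), ‖prodRep π σ t‖ₑ

/-! ### The norms of maps `u : E → B` -/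

/-- The norm of `Id_D ⊗ u : D ⊗_min E → D ⊗_max B`, for `u : E → B` with `E ⊆ A`; the norm of
`D ⊗_min E` is the one induced by `D ⊗_min A`. -/
def minMaxNorm (D : Type u) [NonUnitalCStarAlgebra D] {A B : Type u} [NonUnitalCStarAlgebra A]
    [NonUnitalRing B] [Module ℂ B] [Star B] {E : Submodule ℂ A} (w : E →ₗ[ℂ] B) : ℝ≥0∞ :=
  ⨆ (t : D ⊗[ℂ] E) (_ : minTensorNorm (E.subtype.lTensor D t) ≤ 1), maxTensorNorm (w.lTensor D t)

/-- A class of C*-algebras. -/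
def CStarClass : Type (u + 1) := (D : Type u) → [NonUnitalCStarAlgebra D] → Prop

/-- Stability under `ℓ∞`-sums of arbitrary (non-empty) families. -/
def CStarClass.StableUnderSums (𝒟 : CStarClass.{u}) : Prop :=
  ∀ (I : Type u) [Nonempty I] (D : I → Type u) [∀ i, NonUnitalCStarAlgebra (D i)],
    (∀ i, 𝒟 (D i)) → 𝒟 (lp D ∞)

/-- The class contains a C*-algebra other than `0`. -/
def CStarClass.HasNonzero (𝒟 : CStarClass.{u}) : Prop :=
  ∃ (D : Type u) (_ : NonUnitalCStarAlgebra D), 𝒟 D ∧ Nontrivial D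

/-- The norm of `mM^𝒟(E, B)`: the supremum over `D ∈ 𝒟` of the norms of
`Id_D ⊗ u : D ⊗_min E → D ⊗_max B`. -/
def mMClassNorm (𝒟 : CStarClass.{u}) {A B : Type u} [NonUnitalCStarAlgebra A]
    [NonUnitalRing B] [Module ℂ B] [Star B] {E : Submodule ℂ A} (w : E →ₗ[ℂ] B) : ℝ≥0∞ :=
  ⨆ (D : Type u) (_ : NonUnitalCStarAlgebra D) (_ : 𝒟 D), minMaxNorm D w

/-! ### The full C*-algebra of the free group on countably many generators -/

/-- The Hilbert space `ℓ²(ℕ)`. -/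
abbrev EllTwo : Type := lp (fun _ : ℕ => ℂ) 2

/-- The unitary representations of the free group with generators indexed by `ℕ` on `ℓ²(ℕ)`. As the
group is countable, these determine its full C*-norm. -/
abbrev FreeGroupRep : Type := FreeGroup ℕ →* unitary (EllTwo →L[ℂ] EllTwo)

theorem norm_unitary_le_one (U : unitary (EllTwo →L[ℂ] EllTwo)) :
    ‖(U : EllTwo →L[ℂ] EllTwo)‖ ≤ 1 := by
  have h := CStarRing.norm_star_mul_self (x := (U : EllTwo →L[ℂ] EllTwo))
  rw [Unitary.coe_star_mul_self] at h
  have h1 : ‖(1 : EllTwo →L[ℂ] EllTwo)‖ ≤ 1 := ContinuousLinearMap.norm_id_le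
  nlinarith [norm_nonneg (U : EllTwo →L[ℂ] EllTwo)]

/-- The C*-algebra of bounded families of operators on `ℓ²(ℕ)`, indexed by the representations. -/
def FreeGroupRepOperators : Type := lp (fun _ : FreeGroupRep => EllTwo →L[ℂ] EllTwo) ∞

instance : NonUnitalCStarAlgebra FreeGroupRepOperators :=
  inferInstanceAs (NonUnitalCStarAlgebra (lp (fun _ : FreeGroupRep => EllTwo →L[ℂ] EllTwo) ∞))

/-- The universal representation: `g ↦ (ρ(g))_ρ`. -/
def universalUnitary (g : FreeGroup ℕ) : FreeGroupRepOperators :=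
  show lp (fun _ : FreeGroupRep => EllTwo →L[ℂ] EllTwo) ∞ from ⟨fun ρ => (ρ g : EllTwo →L[ℂ] EllTwo), memℓp_infty ⟨1, by
    rintro _ ⟨ρ, rfl⟩
    exact norm_unitary_le_one (ρ g)⟩⟩

/-- The full C*-algebra `C*(F_∞)`, as the closed *-algebra generated by the universal
representation. -/
def fullFreeGroupSubalgebra : NonUnitalStarSubalgebra ℂ FreeGroupRepOperators :=
  (NonUnitalStarAlgebra.adjoin ℂ (Set.range universalUnitary)).topologicalClosure

instance : IsClosed (fullFreeGroupSubalgebra : Set FreeGroupRepOperators) :=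
  NonUnitalStarSubalgebra.isClosed_topologicalClosure
    (NonUnitalStarAlgebra.adjoin ℂ (Set.range universalUnitary))

/-- `C*(F_∞)` as a type. -/
abbrev FullFreeGroupCStar : Type := fullFreeGroupSubalgebra

/-- The C*-algebra `ℓ∞(𝒞)` of bounded sequences in `𝒞 = C*(F_∞)`. -/
abbrev EllInftyFullFree : Type u :=
  lp (fun _ : ULift.{u} ℕ => FullFreeGroupCStar) ∞

/-- The norm of `mM(E, B)`: the norm of `Id ⊗ u : ℓ∞(𝒞) ⊗_min E → ℓ∞(𝒞) ⊗_max B` with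
`𝒞 = C*(F_∞)`. -/
def mMNorm {A B : Type u} [NonUnitalCStarAlgebra A]
    [NonUnitalRing B] [Module ℂ B] [Star B] {E : Submodule ℂ A} (w : E →ₗ[ℂ] B) : ℝ≥0∞ :=
  minMaxNorm EllInftyFullFree.{u} w

/-! ### Duality between `E ⊗ C*` and the maps `E → C` and `E → C**` -/

section Duality

variable {A C : Type u} [NonUnitalCStarAlgebra A] [NonUnitalCStarAlgebra C] {E : Submodule ℂ A}

/-- The pairing of `z ∈ E ⊗ C*` with `w : E → C**`, `⟨e ⊗ φ, w⟩ = w(e)(φ)`. -/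
def bidualPairing (z : E ⊗[ℂ] StrongDual ℂ C) (w : E →ₗ[ℂ] Bidual C) : ℂ :=
  TensorProduct.lift (Bidual.eval ∘ₗ w) z

/-- The pairing of `z ∈ E ⊗ C*` with `v : E → C`, `⟨e ⊗ φ, v⟩ = φ(v(e))`. -/
def dualPairing (z : E ⊗[ℂ] StrongDual ℂ C) (v : E →ₗ[ℂ] C) : ℂ :=
  bidualPairing z (Bidual.canon ∘ₗ v)

/-- The linear functional `f` is bounded for the norm `N` on the maps `E → C`. -/
def IsBoundedFunctional (N : (E →ₗ[ℂ] C) → ℝ≥0∞) (f : (E →ₗ[ℂ] C) → ℂ) : Prop :=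
  ∃ M : ℝ≥0, ∀ v, ‖f v‖ₑ ≤ M * N v

/-- The dual norm of the functional on the maps `E → C` given by `z ∈ E ⊗ C*`. -/
def dualNorm (N : (E →ₗ[ℂ] C) → ℝ≥0∞) (z : E ⊗[ℂ] StrongDual ℂ C) : ℝ≥0∞ :=
  ⨆ (v : E →ₗ[ℂ] C) (_ : N v ≤ 1), ‖dualPairing z v‖ₑ

/-- The bidual norm of `w : E → C**`, regarded as the functional `z ↦ ⟨z, w⟩` on the dual. -/
def bidualNorm (N : (E →ₗ[ℂ] C) → ℝ≥0∞) (w : E →ₗ[ℂ] Bidual C) : ℝ≥0∞ :=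
  ⨆ (z : E ⊗[ℂ] StrongDual ℂ C) (_ : dualNorm N z ≤ 1), ‖bidualPairing z w‖ₑ

/-- Every functional that is bounded for `N` on the maps `E → C` is given by exactly one element of
`E ⊗ C*`, and the identity, from the maps `E → C**` with the norm `N''` to the bidual of the maps
`E → C` with the norm `N`, is contractive. -/
def IsContractiveIntoBidual (N : (E →ₗ[ℂ] C) → ℝ≥0∞) (N'' : (E →ₗ[ℂ] Bidual C) → ℝ≥0∞) : Prop :=
  (∀ f : (E →ₗ[ℂ] C) →ₗ[ℂ] ℂ, IsBoundedFunctional N f →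
    ∃! z : E ⊗[ℂ] StrongDual ℂ C, ∀ v, f v = dualPairing z v) ∧
  ∀ w : E →ₗ[ℂ] Bidual C, bidualNorm N w ≤ N'' w

/-- Every map `E → C**` in the unit ball of `N''` is the pointwise weak* limit of a net of maps
`E → C` in the unit ball of `N`. -/
def UnitBallsWeakStarDense (N : (E →ₗ[ℂ] C) → ℝ≥0∞) (N'' : (E →ₗ[ℂ] Bidual C) → ℝ≥0∞) : Prop :=
  ∀ w : E →ₗ[ℂ] Bidual C, N'' w ≤ 1 →
    ∃ (ι : Type u) (_ : Preorder ι) (_ : IsDirectedOrder ι) (_ : Nonempty ι) (v : ι → E →ₗ[ℂ] C),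
      (∀ i, N (v i) ≤ 1) ∧
      ∀ (e : E) (φ : StrongDual ℂ C),
        Tendsto (fun i => φ (v i e)) atTop (𝓝 (Bidual.eval (w e) φ))

end Duality

end

/-!
Both parts reduce to the existence of one norming tensor: a C*-algebra `D` and a `t ∈ D ⊗ E` such
that `N v ≤ ‖(Id ⊗ v)(t)‖_max` for every `v : E → C`, while `‖(Id ⊗ w)(t)‖_max ≤ N'' w` for every
`w : E → C**`; here `N` and `N''` are the norms on the maps into `C` and into `C**`.

*Existence of `t`.* For a class stable under `ℓ∞`-sums, choose for each `v` and each `r < N v` some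
`D_j` in the class and `t_j` in the unit ball of `D_j ⊗_min E` with `‖(Id ⊗ v)(t_j)‖_max > r`, and
put `D = ℓ∞(D_j)`, `t = (t_j)` (`exists_attaining_mMClassNorm`). That `(t_j)` is an element of
`D ⊗ E` holds because the coordinates of a tensor in a basis of `E` are bounded by its minimal norm
(`exists_enorm_sliceMap_le`); that `t` lies in the unit ball holds because a jointly faithful family
of homomorphisms of `D` computes the minimal norm (`minTensorNorm_le_of_forall_le`), which rests on
the automatic isometry of injective *-homomorphisms of the C*-algebras `M_n(D)`. For `ℓ∞(𝒞)` only
countable families can be glued, through a bijection of `ℕ × ℕ` with `ℕ`; separability of `C`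
reduces the supremum to such a family, `v ↦ ‖(Id ⊗ v)(t)‖_max` being continuous
(`exists_attaining_minMaxNorm`). Of `𝒞` one needs nothing but `𝒞 ≠ 0`.

*Use of `t`.* Let `f` be a functional on the maps `E → C` with `|f v| ≤ ‖(Id ⊗ v)(t)‖_max`. The
maximal norm is attained in one pair of commuting representations `π`, `σ`
(`exists_rep_maxTensorNorm`), and a functional dominated by an operator norm is a matrix coefficient
in a further representation `R`, with vectors `ξ`, `η` of norm at most one
(`exists_rep_of_norm_le`).
Hence `f` is given by the element `z` of `E ⊗ C*` obtained from `t` by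
`d ⊗ e ↦ e ⊗ ⟨η, Rπ(d) Rσ(·) ξ⟩`. The representation `Rσ` extends to a *-homomorphism of the Arens
algebra `C**` which still commutes with `Rπ` (`normalExtension`), and `⟨z, w⟩` is the corresponding
coefficient of `(Id ⊗ w)(t)`; so `|⟨z, w⟩| ≤ ‖(Id ⊗ w)(t)‖_max` for all `w : E → C**`
(`exists_dualPairing_eq`). This yields the description of the dual and the contractivity, and the
density of the unit ball follows from it by Hahn–Banach separation in finitely many coordinates.

Boundedness of all `z ∈ E ⊗ C*` comes from `‖d‖ ‖c‖ ≤ ‖d ⊗ c‖_max`, applied to a nonzero `d`.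
-/

/-! ### States, representations and direct sums -/

/-- A functional dominated by `v ↦ ‖T v‖` factors through `T` as a contractive functional, by the
Hahn–Banach theorem on the range of `T`. -/
theorem exists_dual_of_norm_le {V M : Type*} [AddCommGroup V] [Module ℂ V]
    [NormedAddCommGroup M] [NormedSpace ℂ M] (T : V →ₗ[ℂ] M) (f : V →ₗ[ℂ] ℂ)
    (h : ∀ v, ‖f v‖ ≤ ‖T v‖) :
    ∃ g : StrongDual ℂ M, ‖g‖ ≤ 1 ∧ ∀ v, g (T v) = f v := by
  obtain ⟨s, hs⟩ := T.rangeRestrict.exists_rightInverse_of_surjective T.range_rangeRestrict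
  have hs' : ∀ y, T (s y) = y := fun y => congrArg Subtype.val (LinearMap.congr_fun hs y)
  have hb : ∀ y : T.range, ‖(f ∘ₗ s) y‖ ≤ 1 * ‖y‖ := fun y => by
    simpa [hs'] using h (s y)
  obtain ⟨g, hg, hn⟩ := exists_extension_norm_eq T.range ((f ∘ₗ s).mkContinuous 1 hb)
  refine ⟨g, hn.trans_le (LinearMap.mkContinuous_norm_le _ zero_le_one _), fun v => ?_⟩
  have h1 := hg (T.rangeRestrict v)
  have h2 := h (s (T.rangeRestrict v) - v)
  rw [map_sub T, hs', map_sub] at h2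
  rw [show ((T.rangeRestrict v : T.range) : M) = T v from rfl, sub_self, norm_zero,
    norm_le_zero_iff] at h2
  simpa [sub_eq_zero.1 h2] using h1

section States

variable {A : Type u} [CStarAlgebra A]

/-- Compare `f` with the norm on the line `s + i r`, whose elements are normal with
`‖s + i r‖² ≤ ‖s‖² + r²`. -/
theorem im_apply_eq_zero_of_isSelfAdjoint (f : StrongDual ℂ A) (hf : ‖f‖ ≤ 1) (h1 : f 1 = 1)
    {s : A} (hs : IsSelfAdjoint s) : (f s).im = 0 := by
  have : Nontrivial A := ⟨1, 0, fun h => by simp [h] at h1⟩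
  have key : ∀ r : ℝ, (f s).im ^ 2 + 2 * (f s).im * r ≤ ‖s‖ ^ 2 := fun r => by
    have e1 : f (s + (r * Complex.I : ℂ) • (1 : A)) = f s + r * Complex.I := by simp [h1]
    have e2 : star (s + (r * Complex.I : ℂ) • (1 : A)) * (s + (r * Complex.I : ℂ) • (1 : A))
        = s * s + (r ^ 2 : ℂ) • (1 : A) := by
      have hI : (r * Complex.I : ℂ) * (r * Complex.I) = - r ^ 2 := by
        ring_nf; simp
      have hst : star (r * Complex.I : ℂ) = -(r * Complex.I) := by simp
      rw [star_add, star_smul, star_one, hs.star_eq, hst]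
      simp only [add_mul, mul_add, smul_mul_assoc, mul_smul_comm, mul_one, one_mul, smul_add, smul_neg,
        smul_smul, neg_smul, hI, neg_mul, neg_neg]
      abel
    have h3 := f.le_of_opNorm_le hf (s + (r * Complex.I : ℂ) • (1 : A))
    rw [e1, one_mul] at h3
    have h4 := CStarRing.norm_star_mul_self (x := s + (r * Complex.I : ℂ) • (1 : A))
    rw [e2] at h4
    have h5 : ‖s * s + (r ^ 2 : ℂ) • (1 : A)‖ ≤ ‖s‖ * ‖s‖ + r ^ 2 := by
      refine (norm_add_le _ _).trans (add_le_add (norm_mul_le _ _) ?_)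
      rw [norm_smul]; simp
    have h6 : ‖f s + r * Complex.I‖ ^ 2 ≤ ‖s‖ * ‖s‖ + r ^ 2 := by
      nlinarith [norm_nonneg (f s + r * Complex.I)]
    rw [← Complex.normSq_eq_norm_sq, Complex.normSq_apply] at h6
    simp at h6
    nlinarith [mul_self_nonneg (f s).re]
  by_contra hne
  have := key ((‖s‖ ^ 2) / (2 * (f s).im))
  rw [mul_div_cancel₀ _ (by simpa using hne)] at this
  have : 0 < (f s).im ^ 2 := by positivity
  linarith

/-- A contractive functional with `f 1 = 1` is positive. -/
theorem apply_nonneg_of_norm_le_one [PartialOrder A] [StarOrderedRing A] (f : StrongDual ℂ A)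
    (hf : ‖f‖ ≤ 1) (h1 : f 1 = 1) {a : A} (ha : 0 ≤ a) : 0 ≤ (f a).re ∧ (f a).im = 0 := by
  refine ⟨?_, im_apply_eq_zero_of_isSelfAdjoint f hf h1 ha.isSelfAdjoint⟩
  have : Nontrivial A := ⟨1, 0, fun h => by simp [h] at h1⟩
  have h2 : ‖algebraMap ℝ A ‖a‖ - a‖ ≤ ‖a‖ := by
    rw [CStarAlgebra.norm_le_iff_le_algebraMap _ (norm_nonneg a)
      (sub_nonneg.2 (IsSelfAdjoint.le_algebraMap_norm_self ha.isSelfAdjoint))]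
    simpa using ha
  have h3 := (f.le_of_opNorm_le hf _).trans (by simpa using h2)
  rw [Algebra.algebraMap_eq_smul_one, ← Complex.coe_smul, map_sub, map_smul, h1] at h3
  have h4 := (Complex.re_le_norm _).trans h3
  simp at h4
  linarith

open scoped ComplexOrder in
/-- The GNS representation of a state, with its cyclic vector. -/
theorem exists_gns (f : StrongDual ℂ A) (hf : ‖f‖ ≤ 1) (h1 : f 1 = 1) :
    ∃ (H : Type u) (_ : NormedAddCommGroup H) (_ : InnerProductSpace ℂ H) (_ : CompleteSpace H)
      (π : A →⋆ₐ[ℂ] (H →L[ℂ] H)) (ξ : H), ∀ a, f a = inner ℂ ξ (π a ξ) := by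
  let _ := CStarAlgebra.spectralOrder A
  let _ := CStarAlgebra.spectralOrderedRing A
  let F : A →ₚ[ℂ] ℂ := PositiveLinearMap.mk₀ f.toLinearMap fun a ha =>
    Complex.nonneg_iff.2 ⟨(apply_nonneg_of_norm_le_one f hf h1 ha).1,
      (apply_nonneg_of_norm_le_one f hf h1 ha).2.symm⟩
  refine ⟨F.GNS, inferInstance, inferInstance, inferInstance, F.gnsStarAlgHom,
    ((F.toPreGNS 1 : F.PreGNS) : F.GNS), fun a => ?_⟩
  change f a = inner ℂ ((F.toPreGNS 1 : F.PreGNS) : F.GNS)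
    (F.gnsNonUnitalStarAlgHom a ((F.toPreGNS 1 : F.PreGNS) : F.GNS))
  rw [PositiveLinearMap.gnsNonUnitalStarAlgHom_apply_coe,
    UniformSpace.Completion.inner_coe, PositiveLinearMap.preGNS_inner_def]
  simp only [PositiveLinearMap.leftMulMapPreGNS_apply, PositiveLinearMap.ofPreGNS_toPreGNS,
    star_one, one_mul]
  change f a = f (a * 1)
  rw [mul_one]

end States

section DirectSum

variable {A : Type u} [NonUnitalCStarAlgebra A] {J : Type u} {H : J → Type u}
  [∀ j, NormedAddCommGroup (H j)] [∀ j, InnerProductSpace ℂ (H j)] [∀ j, CompleteSpace (H j)]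

/-- The direct sum of a family of representations, acting on the Hilbert sum of the spaces. -/
noncomputable def directSumRep (π : ∀ j, A →⋆ₙₐ[ℂ] (H j →L[ℂ] H j)) :
    A →⋆ₙₐ[ℂ] (lp H 2 →L[ℂ] lp H 2) where
  toFun a := lp.mapCLM 2 (fun j => π j a) (norm_nonneg a)
    fun j => NonUnitalStarAlgHom.norm_apply_le (π j) a
  map_smul' c a := by ext; simp
  map_zero' := by ext; simp
  map_add' a b := by ext; simp
  map_mul' a b := by ext; simp
  map_star' a := by
    refine (ContinuousLinearMap.eq_adjoint_iff _ _).2 fun x y => ?_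
    rw [lp.inner_eq_tsum, lp.inner_eq_tsum]
    refine tsum_congr fun j => ?_
    change inner ℂ (π j (star a) (x j)) (y j) = inner ℂ (x j) (π j a (y j))
    rw [map_star, ContinuousLinearMap.star_eq_adjoint, ContinuousLinearMap.adjoint_inner_left]

theorem directSumRep_apply (π : ∀ j, A →⋆ₙₐ[ℂ] (H j →L[ℂ] H j)) (a : A) (x : lp H 2) (j : J) :
    directSumRep π a x j = π j a (x j) := rfl

end DirectSum

/-- The representation is the GNS representation of a state of the unitization that takes a value of
maximal modulus in the spectrum at `a* a`. -/
theorem exists_rep_ne_zero {A : Type u} [NonUnitalCStarAlgebra A] {a : A} (ha : a ≠ 0) :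
    ∃ (H : Type u) (_ : NormedAddCommGroup H) (_ : InnerProductSpace ℂ H) (_ : CompleteSpace H)
      (π : A →⋆ₙₐ[ℂ] (H →L[ℂ] H)), π a ≠ 0 := by
  let b : Unitization ℂ A := ((star a * a : A) : Unitization ℂ A)
  have hb : IsSelfAdjoint b := by
    have := IsSelfAdjoint.star_mul_self a
    exact this.map (Unitization.inrNonUnitalStarAlgHom ℂ A)
  have hb0 : ‖b‖ = ‖a‖ * ‖a‖ := by
    rw [Unitization.norm_inr, CStarRing.norm_star_mul_self]
  obtain ⟨l, hl, hl'⟩ : ∃ l ∈ spectrum ℂ b, (‖l‖₊ : ℝ≥0∞) = spectralRadius ℂ b :=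
    spectrum.exists_nnnorm_eq_spectralRadius b
  rw [hb.spectralRadius_eq_nnnorm] at hl'
  have hl0 : l ≠ 0 := by
    rintro rfl
    have h0 : ‖b‖ = 0 := by
      have : ‖b‖₊ = 0 := by simpa using hl'.symm
      simpa using congrArg NNReal.toReal this
    rw [hb0] at h0
    simp_all
  obtain ⟨f, hf, hf'⟩ := exists_dual_of_norm_le
    (LinearMap.coprod (LinearMap.toSpanSingleton ℂ (Unitization ℂ A) 1)
      (LinearMap.toSpanSingleton ℂ (Unitization ℂ A) b))
    (LinearMap.coprod LinearMap.id (LinearMap.toSpanSingleton ℂ ℂ l)) (fun v => by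
      refine spectrum.norm_le_norm_of_mem ?_
      have := spectrum.subset_polynomial_aeval b (Polynomial.C v.1 + Polynomial.C v.2 * Polynomial.X)
        ⟨l, hl, rfl⟩
      simpa [Algebra.algebraMap_eq_smul_one] using this)
  obtain ⟨H, i1, i2, i3, π, ξ, hπ⟩ := exists_gns f hf (by simpa using hf' (1, 0))
  refine ⟨H, i1, i2, i3, (π : Unitization ℂ A →⋆ₙₐ[ℂ] (H →L[ℂ] H)).comp
    (Unitization.inrNonUnitalStarAlgHom ℂ A), fun h0 => hl0 ?_⟩
  have h0' : π (a : Unitization ℂ A) = 0 := h0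
  have h1 : f b = l := by simpa using hf' (0, 1)
  rw [← h1, hπ, show b = star (a : Unitization ℂ A) * (a : Unitization ℂ A) by simp [b], map_mul, h0']
  simp

/-- Every C*-algebra has a faithful representation (Gelfand–Naimark). -/
theorem exists_injective_rep (A : Type u) [NonUnitalCStarAlgebra A] :
    ∃ (H : Type u) (_ : NormedAddCommGroup H) (_ : InnerProductSpace ℂ H) (_ : CompleteSpace H)
      (π : A →⋆ₙₐ[ℂ] (H →L[ℂ] H)), Function.Injective π := by
  classical
  choose H i1 i2 i3 π hπ using fun a : {a : A // a ≠ 0} => exists_rep_ne_zero a.2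
  refine ⟨lp H 2, inferInstance, inferInstance, inferInstance, directSumRep π, ?_⟩
  refine (injective_iff_map_eq_zero _).2 fun a ha => ?_
  by_contra hne
  refine hπ ⟨a, hne⟩ (ContinuousLinearMap.ext fun x => ?_)
  have h := congrArg (fun T => T (lp.single 2 ⟨a, hne⟩ x) ⟨a, hne⟩) ha
  simpa [directSumRep_apply] using h

/-! ### Functionals dominated by an operator norm are matrix coefficients -/

section MatrixOperators

variable {n : Type} [Fintype n] [DecidableEq n]
  {H : Type u} [NormedAddCommGroup H] [InnerProductSpace ℂ H]

/-- The operator `e_ij ⊗ x` on the Hilbert sum of copies of `H` indexed by `n`: it sends `u` to the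
vector whose only nonzero coordinate is `x (u j)`, in position `i`. -/
noncomputable def matUnit (i j : n) : (H →L[ℂ] H) →ₗ[ℂ]
    (PiLp 2 (fun _ : n => H) →L[ℂ] PiLp 2 (fun _ : n => H)) where
  toFun x := (PiLp.continuousLinearEquiv 2 ℂ (fun _ : n => H)).symm.toContinuousLinearMap ∘L
    ContinuousLinearMap.single ℂ (fun _ : n => H) i ∘L x ∘L PiLp.proj 2 (fun _ : n => H) j
  map_add' x y := by ext u k; simp
  map_smul' c x := by ext u k; simp

theorem matUnit_apply (i j : n) (x : H →L[ℂ] H) (u : PiLp 2 (fun _ : n => H)) (k : n) :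
    matUnit i j x u k = if k = i then x (u j) else 0 := by
  simp [matUnit]

theorem matUnit_mul (i j k l : n) (x y : H →L[ℂ] H) :
    matUnit i j x * matUnit k l y = if j = k then matUnit i l (x * y) else 0 := by
  ext u m
  split_ifs with h <;> simp [matUnit_apply, h]

theorem inner_matUnit (i j : n) (x : H →L[ℂ] H) (u v : PiLp 2 (fun _ : n => H)) :
    inner ℂ u (matUnit i j x v) = inner ℂ (u i) (x (v j)) := by
  rw [PiLp.inner_apply, Finset.sum_eq_single i]
  · simp [matUnit_apply]
  · intro k _ hk; simp [matUnit_apply, hk]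
  · simp

theorem star_matUnit [CompleteSpace H] (i j : n) (x : H →L[ℂ] H) :
    star (matUnit i j x) = matUnit j i (star x) := by
  refine ((ContinuousLinearMap.eq_adjoint_iff _ _).2 fun u v => ?_).symm
  rw [inner_matUnit, ← inner_conj_symm, inner_matUnit, inner_conj_symm,
    ContinuousLinearMap.star_eq_adjoint, ContinuousLinearMap.adjoint_inner_left]

theorem sum_matUnit_one : ∑ i : n, matUnit i i (1 : H →L[ℂ] H) = 1 := by
  ext u k
  simp [matUnit_apply]

theorem sum_matUnit_apply (x : H →L[ℂ] H) (u : PiLp 2 (fun _ : n => H)) (k : n) :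
    (∑ i, matUnit i i x) u k = x (u k) := by
  simp [matUnit_apply]

/-- The amplification `x ↦ 1 ⊗ x`. -/
noncomputable def diagHom (n : Type) [Fintype n] [DecidableEq n] (H : Type u)
    [NormedAddCommGroup H] [InnerProductSpace ℂ H] [CompleteSpace H] : (H →L[ℂ] H) →⋆ₙₐ[ℂ]
    (PiLp 2 (fun _ : n => H) →L[ℂ] PiLp 2 (fun _ : n => H)) where
  toFun x := ∑ i, matUnit i i x
  map_smul' c x := by simp only [map_smul, Finset.smul_sum]; rfl
  map_zero' := Finset.sum_eq_zero fun i _ => map_zero _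
  map_add' x y := by simp [Finset.sum_add_distrib]
  map_mul' x y := by
    change ∑ i, matUnit i i (x * y) = (∑ i, matUnit i i x) * ∑ i, matUnit i i y
    simp [Finset.sum_mul_sum, matUnit_mul]
  map_star' x := by
    refine (ContinuousLinearMap.eq_adjoint_iff _ _).2 fun u v => ?_
    rw [PiLp.inner_apply, PiLp.inner_apply]
    refine Finset.sum_congr rfl fun k _ => ?_
    rw [sum_matUnit_apply, sum_matUnit_apply, ContinuousLinearMap.star_eq_adjoint,
      ContinuousLinearMap.adjoint_inner_left]

end MatrixOperators

/-- The functional `(a, b, x) ↦ (a + b + f x) / 2` of the operator matrix with rows `(a, x)` and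
`(0, b)` is contractive as soon as `f` is: this is the norm estimate behind it. -/
theorem norm_add_add_le_two_mul_norm {H : Type u} [NormedAddCommGroup H] [InnerProductSpace ℂ H]
    [CompleteSpace H] [Nontrivial H] (a b : ℂ) (x : H →L[ℂ] H) :
    ‖a + b‖ + ‖x‖ ≤
      2 * ‖a • matUnit (0 : Fin 2) 0 (1 : H →L[ℂ] H) + b • matUnit 1 1 1 + matUnit 0 1 x‖ := by
  set S := a • matUnit (0 : Fin 2) 0 (1 : H →L[ℂ] H) + b • matUnit 1 1 1 + matUnit 0 1 x with hS
  -- evaluation of the quadratic form of `S` at the vector `(h, k)`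
  have key : ∀ h k : H, ‖h‖ = 1 → ‖k‖ = 1 → ‖a + b + inner ℂ h (x k)‖ ≤ 2 * ‖S‖ := by
    intro h k hh hk
    let u : PiLp 2 (fun _ : Fin 2 => H) := WithLp.toLp 2 ![h, k]
    have h1 : inner ℂ u (S u) = a + b + inner ℂ h (x k) := by
      simp only [hS, add_apply, smul_apply, inner_add_right, inner_smul_right, inner_matUnit]
      simp [u, inner_self_eq_norm_sq_to_K, hh, hk]
    have h2 : ‖u‖ * ‖u‖ = 2 := by
      have := PiLp.norm_sq_eq_of_L2 (fun _ : Fin 2 => H) u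
      simp [u, hh, hk] at this
      rw [← sq, this]; norm_num
    rw [← h1]
    calc _ ≤ ‖u‖ * (‖S‖ * ‖u‖) :=
          (norm_inner_le_norm _ _).trans (by gcongr; exact S.le_opNorm u)
      _ = 2 * ‖S‖ := by rw [← h2]; ring
  obtain ⟨c, hc, hc'⟩ : ∃ c : ℂ, ‖c‖ = 1 ∧ a + b = ‖a + b‖ * c := by
    by_cases h0 : a + b = 0
    · exact ⟨1, by simp, by simp [h0]⟩
    · exact ⟨(a + b) / ‖a + b‖, by simp [h0],
        (mul_div_cancel₀ _ (by simpa using h0)).symm⟩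
  have key2 : ∀ k : H, ‖k‖ = 1 → ‖x k‖ ≤ 2 * ‖S‖ - ‖a + b‖ := by
    intro k hk
    by_cases hx : x k = 0
    · have := key k k hk hk
      simp only [hx, inner_zero_right, add_zero, norm_zero] at this ⊢
      linarith
    · -- the vector in the direction of `x k` whose phase agrees with that of `a + b`
      let h : H := (star c * (‖x k‖⁻¹ : ℝ)) • x k
      have hh : ‖h‖ = 1 := by
        simp only [h, norm_smul, norm_mul, norm_star, hc, Complex.norm_real, norm_inv, norm_norm]
        simp [hx]
      have h1 : inner ℂ h (x k) = c * ‖x k‖ := by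
        simp only [h, inner_smul_left, inner_self_eq_norm_sq_to_K]
        simp
        field_simp
      have h2 := key h k hh hk
      rw [h1, hc', mul_comm c, ← add_mul, norm_mul, hc, mul_one, ← Complex.ofReal_add,
        Complex.norm_real, Real.norm_of_nonneg (by positivity)] at h2
      linarith
  have h0 : 0 ≤ 2 * ‖S‖ - ‖a + b‖ := by
    obtain ⟨k, hk⟩ := exists_norm_eq H (zero_le_one (α := ℝ))
    exact (norm_nonneg _).trans (key2 k hk)
  have := ContinuousLinearMap.opNorm_le_of_unit_norm h0 key2
  linarith

/-- A functional `f` with `|f v| ≤ ‖T v‖` is a matrix coefficient of `R ∘ T` for a representation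
`R` of `B(H)`, with vectors of norm at most one. The functional `(a, b, v) ↦ (a + b + f v) / 2` of
the operator matrices with rows `(a, T v)` and `(0, b)` extends to a contractive functional on
`B(H ⊕ H)`, which is a state because it is unital; its GNS representation, restricted to the
diagonal copy of `B(H)`, gives `R`. -/
theorem exists_rep_of_norm_le {V : Type*} [AddCommGroup V] [Module ℂ V] {H : Type u}
    [NormedAddCommGroup H] [InnerProductSpace ℂ H] [CompleteSpace H]
    (T : V →ₗ[ℂ] (H →L[ℂ] H)) (f : V →ₗ[ℂ] ℂ) (hf : ∀ v, ‖f v‖ ≤ ‖T v‖) :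
    ∃ (K : Type u) (_ : NormedAddCommGroup K) (_ : InnerProductSpace ℂ K) (_ : CompleteSpace K)
      (R : (H →L[ℂ] H) →⋆ₙₐ[ℂ] (K →L[ℂ] K)) (ξ η : K), ‖ξ‖ ≤ 1 ∧ ‖η‖ ≤ 1 ∧
      ∀ v, f v = inner ℂ η (R (T v) ξ) := by
  -- on `H = 0` the unit of `B(H ⊕ H)` is `0` and there is no state, but then `f = 0`
  rcases subsingleton_or_nontrivial H with hH | hH
  · refine ⟨H, inferInstance, inferInstance, inferInstance, 0, 0, 0, by simp, by simp, fun v => ?_⟩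
    have := hf v
    rw [Subsingleton.elim (T v) 0] at this
    simpa using this
  -- `S (a, b, v)` is the operator matrix with rows `(a, T v)` and `(0, b)`
  let S : (ℂ × ℂ) × V →ₗ[ℂ]
      (PiLp 2 (fun _ : Fin 2 => H) →L[ℂ] PiLp 2 (fun _ : Fin 2 => H)) :=
    ((LinearMap.toSpanSingleton ℂ _ (matUnit 0 0 1)).coprod
      (LinearMap.toSpanSingleton ℂ _ (matUnit 1 1 1))).coprod (matUnit 0 1 ∘ₗ T)
  obtain ⟨F, hF, hF'⟩ := exists_dual_of_norm_le S
    ((1 / 2 : ℂ) • (LinearMap.coprod LinearMap.id LinearMap.id).coprod f) (fun v => by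
      have h1 := norm_add_add_le_two_mul_norm v.1.1 v.1.2 (T v.2)
      have h2 : ‖v.1.1 + v.1.2 + f v.2‖ ≤ ‖v.1.1 + v.1.2‖ + ‖T v.2‖ :=
        (norm_add_le _ _).trans (by gcongr; exact hf _)
      have h3 : S v = v.1.1 • matUnit (0 : Fin 2) 0 (1 : H →L[ℂ] H) + v.1.2 • matUnit 1 1 1 +
        matUnit 0 1 (T v.2) := rfl
      rw [h3]
      simp only [LinearMap.smul_apply, LinearMap.coprod_apply, LinearMap.id_apply,
        smul_eq_mul, norm_mul, one_div, norm_inv, Complex.norm_ofNat]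
      linarith)
  have e00 : F (matUnit 0 0 1) = 1 / 2 := by simpa [S] using hF' ((1, 0), 0)
  have e11 : F (matUnit 1 1 1) = 1 / 2 := by simpa [S] using hF' ((0, 1), 0)
  have e01 : ∀ v, F (matUnit 0 1 (T v)) = 1 / 2 * f v := fun v => by
    simpa [S] using hF' ((0, 0), v)
  obtain ⟨K, i1, i2, i3, π, ζ, hπ⟩ := exists_gns F hF (by
    rw [← sum_matUnit_one, Fin.sum_univ_two, map_add, e00, e11]; norm_num)
  have hnorm : ∀ X Y : PiLp 2 (fun _ : Fin 2 => H) →L[ℂ] PiLp 2 (fun _ : Fin 2 => H),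
      inner ℂ (π X ζ) (π Y ζ) = F (star X * Y) := fun X Y => by
    rw [hπ, map_mul, map_star, ContinuousLinearMap.star_eq_adjoint]
    simp [ContinuousLinearMap.adjoint_inner_right]
  have hsqrt : ((√2 : ℝ) : ℂ) * ((√2 : ℝ) : ℂ) = 2 := by
    rw [← Complex.ofReal_mul, Real.mul_self_sqrt (by norm_num)]; simp
  have hle : ∀ x : K, inner ℂ x x = 1 → ‖x‖ ≤ 1 := fun x hx => by
    rw [inner_self_eq_norm_sq_to_K] at hx
    have : ‖x‖ ^ 2 = 1 := Complex.ofReal_injective (by simpa using hx)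
    nlinarith [norm_nonneg x]
  refine ⟨K, i1, i2, i3, (π : _ →⋆ₙₐ[ℂ] (K →L[ℂ] K)).comp (diagHom (Fin 2) H),
    -- since `e₁₁ x e₁₂ = e₁₂ x`, the coefficient of `x` at these vectors is `2 F (e₁₂ ⊗ x)`; the
    -- factors `√2` normalize them because `F` is `1 / 2` at both diagonal units
    ((√2 : ℝ) : ℂ) • π (matUnit 0 1 1) ζ, ((√2 : ℝ) : ℂ) • π (matUnit 0 0 1) ζ, ?_, ?_, ?_⟩
  · apply hle
    rw [inner_smul_left, inner_smul_right, hnorm, star_matUnit, matUnit_mul, if_pos rfl,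
      star_one, one_mul, e11, Complex.conj_ofReal, ← mul_assoc, hsqrt]
    norm_num
  · apply hle
    rw [inner_smul_left, inner_smul_right, hnorm, star_matUnit, matUnit_mul, if_pos rfl,
      star_one, one_mul, e00, Complex.conj_ofReal, ← mul_assoc, hsqrt]
    norm_num
  · intro v
    have h1 : ((π : _ →⋆ₙₐ[ℂ] (K →L[ℂ] K)).comp (diagHom (Fin 2) H)) (T v) =
      π (∑ i, matUnit i i (T v)) := rfl
    have h2 : π (∑ i, matUnit i i (T v)) (π (matUnit 0 1 1) ζ) = π (matUnit 0 1 (T v)) ζ := by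
      rw [← mul_apply_eq_comp, ← map_mul, Finset.sum_mul]
      simp [matUnit_mul]
    rw [h1, map_smul, h2, inner_smul_left, inner_smul_right, hnorm, star_matUnit, matUnit_mul,
      if_pos rfl, star_one, one_mul, e01, Complex.conj_ofReal, ← mul_assoc, hsqrt]
    ring

/-! ### The normal extension of a representation to the bidual -/

section NormalExtension

variable {C H : Type u} [NonUnitalCStarAlgebra C] [NormedAddCommGroup H] [InnerProductSpace ℂ H]
  [CompleteSpace H]

/-- The coefficient functional `c ↦ ⟨η, σ(c) ξ⟩` of a representation. -/
noncomputable def coeffFunctional (σ : C →⋆ₙₐ[ℂ] (H →L[ℂ] H)) (η ξ : H) : StrongDual ℂ C :=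
  LinearMap.mkContinuous
    { toFun := fun c => inner ℂ η (σ c ξ)
      map_add' := fun a b => by simp
      map_smul' := fun a b => by simp }
    (‖η‖ * ‖ξ‖) fun c => by
      calc _ ≤ ‖η‖ * (‖σ c‖ * ‖ξ‖) :=
            (norm_inner_le_norm _ _).trans (by gcongr; exact (σ c).le_opNorm ξ)
        _ ≤ ‖η‖ * (‖c‖ * ‖ξ‖) := by gcongr; exact NonUnitalStarAlgHom.norm_apply_le σ c
        _ = _ := by ring

theorem coeffFunctional_apply (σ : C →⋆ₙₐ[ℂ] (H →L[ℂ] H)) (η ξ : H) (c : C) :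
    coeffFunctional σ η ξ c = inner ℂ η (σ c ξ) := rfl

theorem norm_coeffFunctional_le (σ : C →⋆ₙₐ[ℂ] (H →L[ℂ] H)) (η ξ : H) :
    ‖coeffFunctional σ η ξ‖ ≤ ‖η‖ * ‖ξ‖ :=
  LinearMap.mkContinuous_norm_le _ (by positivity) _

/-- The sesquilinear form `(η, ξ) ↦ F (c ↦ ⟨η, σ(c) ξ⟩)` of `F ∈ C**`. -/
noncomputable def normalForm (σ : C →⋆ₙₐ[ℂ] (H →L[ℂ] H)) (F : Bidual C) :
    H →L⋆[ℂ] H →L[ℂ] ℂ :=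
  LinearMap.mkContinuous₂
    (LinearMap.mk₂'ₛₗ (starRingEnd ℂ) (RingHom.id ℂ)
      (fun η ξ => Bidual.eval F (coeffFunctional σ η ξ))
      (fun η η' ξ => by
        rw [← map_add]; congr 1; ext c; simp [coeffFunctional_apply])
      (fun a η ξ => by
        rw [← map_smul]; congr 1; ext c; simp [coeffFunctional_apply, mul_comm])
      (fun η ξ ξ' => by
        rw [← map_add]; congr 1; ext c; simp [coeffFunctional_apply])
      (fun a η ξ => by
        rw [← map_smul]; congr 1; ext c; simp [coeffFunctional_apply]))
    ‖(show StrongDual ℂ C →L[ℂ] ℂ from F)‖ fun η ξ => by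
      have h := (show StrongDual ℂ C →L[ℂ] ℂ from F).le_opNorm (coeffFunctional σ η ξ)
      rw [mul_assoc]
      exact h.trans (mul_le_mul_of_nonneg_left (norm_coeffFunctional_le σ η ξ) (norm_nonneg _))

/-- The operator representing `normalForm σ F`. -/
noncomputable def normalOp (σ : C →⋆ₙₐ[ℂ] (H →L[ℂ] H)) (F : Bidual C) : H →L[ℂ] H :=
  ContinuousLinearMap.adjoint (InnerProductSpace.continuousLinearMapOfBilin (normalForm σ F))

theorem inner_normalOp (σ : C →⋆ₙₐ[ℂ] (H →L[ℂ] H)) (F : Bidual C) (η ξ : H) :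
    inner ℂ η (normalOp σ F ξ) = Bidual.eval F (coeffFunctional σ η ξ) := by
  rw [normalOp, ContinuousLinearMap.adjoint_inner_right,
    InnerProductSpace.continuousLinearMapOfBilin_apply]
  rfl

theorem inner_normalOp_right (σ : C →⋆ₙₐ[ℂ] (H →L[ℂ] H)) (F : Bidual C) (η ξ : H) :
    inner ℂ (normalOp σ F ξ) η = star (Bidual.eval F (coeffFunctional σ η ξ)) := by
  rw [← inner_normalOp, ← inner_conj_symm]
  rfl

/-- The extension of a representation `σ` of `C` to the bidual `C**`: it sends `F` to the operator
with coefficients `⟨η, σ''(F) ξ⟩ = F (c ↦ ⟨η, σ(c) ξ⟩)`. -/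
noncomputable def normalExtension (σ : C →⋆ₙₐ[ℂ] (H →L[ℂ] H)) :
    Bidual C →⋆ₙₐ[ℂ] (H →L[ℂ] H) where
  toFun := normalOp σ
  map_smul' a F := by
    refine ContinuousLinearMap.ext fun ξ => ext_inner_left ℂ fun η => ?_
    simp [inner_normalOp, inner_smul_right]
  map_zero' := by
    refine ContinuousLinearMap.ext fun ξ => ext_inner_left ℂ fun η => ?_
    simp [inner_normalOp]
  map_add' F G := by
    refine ContinuousLinearMap.ext fun ξ => ext_inner_left ℂ fun η => ?_
    simp [inner_normalOp, inner_add_right]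
  map_mul' F G := by
    refine ContinuousLinearMap.ext fun ξ => ext_inner_left ℂ fun η => ?_
    rw [mul_apply_eq_comp, inner_normalOp, inner_normalOp, Bidual.eval_mul]
    congr 1
    ext a
    rw [Bidual.act_apply, coeffFunctional_apply, ← ContinuousLinearMap.adjoint_inner_left,
      inner_normalOp]
    congr 1
    ext b
    rw [ContinuousLinearMap.comp_apply, coeffFunctional_apply, coeffFunctional_apply,
      ContinuousLinearMap.adjoint_inner_left, ContinuousLinearMap.mul_apply', map_mul,
      mul_apply_eq_comp]
  map_star' F := by
    refine (ContinuousLinearMap.eq_adjoint_iff _ _).2 fun ξ η => ?_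
    rw [inner_normalOp, inner_normalOp_right, Bidual.eval_star, star_star]
    congr 1
    ext c
    rw [Bidual.dualStar_apply, coeffFunctional_apply, coeffFunctional_apply, map_star,
      ContinuousLinearMap.star_eq_adjoint, ContinuousLinearMap.adjoint_inner_right]
    exact inner_conj_symm _ _

theorem inner_normalExtension (σ : C →⋆ₙₐ[ℂ] (H →L[ℂ] H)) (F : Bidual C) (η ξ : H) :
    inner ℂ η (normalExtension σ F ξ) = Bidual.eval F (coeffFunctional σ η ξ) :=
  inner_normalOp σ F η ξ

theorem commute_normalExtension (σ : C →⋆ₙₐ[ℂ] (H →L[ℂ] H)) (T : H →L[ℂ] H)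
    (hT : ∀ c, Commute T (σ c)) (F : Bidual C) : Commute T (normalExtension σ F) := by
  refine ContinuousLinearMap.ext fun ξ => ext_inner_left ℂ fun η => ?_
  rw [mul_apply_eq_comp, mul_apply_eq_comp, ← ContinuousLinearMap.adjoint_inner_left,
    inner_normalExtension, inner_normalExtension]
  congr 1
  ext c
  have h := congrArg (fun S => S ξ) (hT c).eq
  simp only [mul_apply_eq_comp] at h
  rw [coeffFunctional_apply, coeffFunctional_apply, ContinuousLinearMap.adjoint_inner_left, h]

end NormalExtension

/-! ### The maximal norm in one representation -/

section MaxNorm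

theorem prodRep_tmul {D B H : Type u} [NonUnitalCStarAlgebra D] [NonUnitalRing B] [Module ℂ B]
    [Star B] [NormedAddCommGroup H] [InnerProductSpace ℂ H] [CompleteSpace H]
    (π : D →⋆ₙₐ[ℂ] (H →L[ℂ] H)) (σ : B →⋆ₙₐ[ℂ] (H →L[ℂ] H)) (d : D) (b : B) :
    prodRep π σ (d ⊗ₜ b) = π d * σ b := rfl

theorem enorm_prodRep_le_maxTensorNorm {D B H : Type u} [NonUnitalCStarAlgebra D]
    [NonUnitalRing B] [Module ℂ B]
    [Star B] [NormedAddCommGroup H] [InnerProductSpace ℂ H] [CompleteSpace H]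
    (π : D →⋆ₙₐ[ℂ] (H →L[ℂ] H)) (σ : B →⋆ₙₐ[ℂ] (H →L[ℂ] H)) (h : ∀ d b, Commute (π d) (σ b))
    (t : D ⊗[ℂ] B) : ‖prodRep π σ t‖ₑ ≤ maxTensorNorm t := by
  unfold maxTensorNorm
  refine le_iSup_of_le H <| le_iSup_of_le _ <| le_iSup_of_le _ <| le_iSup_of_le _ <|
    le_iSup_of_le π <| le_iSup_of_le σ <| le_iSup_of_le h le_rfl

theorem prodRep_comp {D C H K : Type u} [NonUnitalCStarAlgebra D] [NonUnitalCStarAlgebra C]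
    [NormedAddCommGroup H] [InnerProductSpace ℂ H] [CompleteSpace H]
    [NormedAddCommGroup K] [InnerProductSpace ℂ K] [CompleteSpace K]
    (R : (H →L[ℂ] H) →⋆ₙₐ[ℂ] (K →L[ℂ] K))
    (π : D →⋆ₙₐ[ℂ] (H →L[ℂ] H)) (σ : C →⋆ₙₐ[ℂ] (H →L[ℂ] H)) (t : D ⊗[ℂ] C) :
    prodRep (R.comp π) (R.comp σ) t = R (prodRep π σ t) := by
  induction t with
  | zero => simp
  | tmul d c => simp [prodRep_tmul]
  | add x y hx hy => simp [hx, hy]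

theorem prodRep_directSumRep_apply {D C J : Type u} [NonUnitalCStarAlgebra D]
    [NonUnitalCStarAlgebra C] {H : J → Type u}
    [∀ j, NormedAddCommGroup (H j)] [∀ j, InnerProductSpace ℂ (H j)] [∀ j, CompleteSpace (H j)]
    (π : ∀ j, D →⋆ₙₐ[ℂ] (H j →L[ℂ] H j)) (σ : ∀ j, C →⋆ₙₐ[ℂ] (H j →L[ℂ] H j))
    (t : D ⊗[ℂ] C) (x : lp H 2) (j : J) :
    prodRep (directSumRep π) (directSumRep σ) t x j = prodRep (π j) (σ j) t (x j) := by
  induction t with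
  | zero => simp
  | tmul d c => rfl
  | add y z hy hz => simp [hy, hz]

/-- The maximal norm is attained, for all tensors at once, by one pair of commuting
representations. -/
theorem exists_rep_maxTensorNorm (D C : Type u) [NonUnitalCStarAlgebra D]
    [NonUnitalCStarAlgebra C] :
    ∃ (H : Type u) (_ : NormedAddCommGroup H) (_ : InnerProductSpace ℂ H) (_ : CompleteSpace H)
      (π : D →⋆ₙₐ[ℂ] (H →L[ℂ] H)) (σ : C →⋆ₙₐ[ℂ] (H →L[ℂ] H)),
      (∀ d c, Commute (π d) (σ c)) ∧ ∀ t : D ⊗[ℂ] C, maxTensorNorm t = ‖prodRep π σ t‖ₑ := by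
  classical
  have h : ∀ p : {p : (D ⊗[ℂ] C) × ℝ≥0∞ // p.2 < maxTensorNorm p.1},
      ∃ (H : Type u) (_ : NormedAddCommGroup H) (_ : InnerProductSpace ℂ H) (_ : CompleteSpace H)
        (π : D →⋆ₙₐ[ℂ] (H →L[ℂ] H)) (σ : C →⋆ₙₐ[ℂ] (H →L[ℂ] H)),
        (∀ d c, Commute (π d) (σ c)) ∧ p.1.2 < ‖prodRep π σ p.1.1‖ₑ := by
    rintro ⟨⟨t, r⟩, hr⟩
    simpa only [maxTensorNorm, lt_iSup_iff, exists_prop] using hr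
  choose H i1 i2 i3 π σ hc hr using h
  have hcomm : ∀ d c, Commute (directSumRep π d) (directSumRep σ c) := fun d c => by
    refine ContinuousLinearMap.ext fun x => lp.ext (funext fun j => ?_)
    exact congrArg (fun S => S (x j)) (hc j d c).eq
  refine ⟨lp H 2, inferInstance, inferInstance, inferInstance, directSumRep π, directSumRep σ,
    hcomm, fun t => le_antisymm (le_of_forall_lt fun r hlt => ?_)
      (enorm_prodRep_le_maxTensorNorm _ _ hcomm t)⟩
  let j : {p : (D ⊗[ℂ] C) × ℝ≥0∞ // p.2 < maxTensorNorm p.1} := ⟨(t, r), hlt⟩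
  refine (hr j).trans_le ?_
  rw [enorm_le_iff_norm_le]
  refine ContinuousLinearMap.opNorm_le_bound _ (norm_nonneg _) fun x => ?_
  have h1 := prodRep_directSumRep_apply π σ t (lp.single 2 j x) j
  rw [lp.single_apply_self] at h1
  rw [← h1]
  refine (lp.norm_apply_le_norm (by simp) _ j).trans ((ContinuousLinearMap.le_opNorm _ _).trans ?_)
  rw [lp.norm_single (by simp)]

end MaxNorm

/-! ### The duality between `E ⊗ C*` and linear maps -/

section Pairing

variable {A C : Type u} [NonUnitalCStarAlgebra A] [NonUnitalCStarAlgebra C] {E : Submodule ℂ A}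

theorem bidualPairing_tmul (e : E) (φ : StrongDual ℂ C) (w : E →ₗ[ℂ] Bidual C) :
    bidualPairing (e ⊗ₜ φ) w = Bidual.eval (w e) φ := rfl

theorem dualPairing_tmul (e : E) (φ : StrongDual ℂ C) (v : E →ₗ[ℂ] C) :
    dualPairing (e ⊗ₜ φ) v = φ (v e) := rfl

theorem bidualPairing_add (y z : E ⊗[ℂ] StrongDual ℂ C) (w : E →ₗ[ℂ] Bidual C) :
    bidualPairing (y + z) w = bidualPairing y w + bidualPairing z w := map_add _ _ _

theorem bidualPairing_smul (c : ℂ) (z : E ⊗[ℂ] StrongDual ℂ C) (w : E →ₗ[ℂ] Bidual C) :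
    bidualPairing (c • z) w = c * bidualPairing z w := map_smul _ _ _

theorem bidualPairing_zero (w : E →ₗ[ℂ] Bidual C) :
    bidualPairing (0 : E ⊗[ℂ] StrongDual ℂ C) w = 0 := map_zero _

theorem bidualPairing_sum {ι : Type*} (s : Finset ι) (z : ι → E ⊗[ℂ] StrongDual ℂ C)
    (w : E →ₗ[ℂ] Bidual C) :
    bidualPairing (∑ i ∈ s, z i) w = ∑ i ∈ s, bidualPairing (z i) w := map_sum _ _ _

/-- The pairing with a fixed `z ∈ E ⊗ C*`, as a linear functional on the maps `E → C`. -/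
noncomputable def dualPairingₗ (z : E ⊗[ℂ] StrongDual ℂ C) : (E →ₗ[ℂ] C) →ₗ[ℂ] ℂ where
  toFun := dualPairing z
  map_add' v v' := by
    induction z with
    | zero => simp [dualPairing, bidualPairing_zero]
    | tmul e φ => simp [dualPairing_tmul]
    | add x y hx hy =>
      simp only [dualPairing, bidualPairing_add] at hx hy ⊢
      rw [hx, hy]; ring
  map_smul' c v := by
    induction z with
    | zero => simp [dualPairing, bidualPairing_zero]
    | tmul e φ => simp [dualPairing_tmul]
    | add x y hx hy =>
      simp only [dualPairing, bidualPairing_add] at hx hy ⊢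
      rw [hx, hy, smul_add]

theorem eq_of_dualPairing_eq [FiniteDimensional ℂ E] {y z : E ⊗[ℂ] StrongDual ℂ C}
    (h : ∀ v, dualPairing y v = dualPairing z v) : y = z := by
  let b := Module.finBasis ℂ E
  suffices H : ∀ z : E ⊗[ℂ] StrongDual ℂ C, (∀ v, dualPairing z v = 0) → z = 0 by
    refine sub_eq_zero.1 (H _ fun v => ?_)
    rw [sub_eq_add_neg, ← neg_one_smul ℂ z]
    simp only [dualPairing, bidualPairing_add, bidualPairing_smul] at h ⊢
    rw [h v]; ring
  intro z hz
  obtain ⟨c, rfl⟩ := TensorProduct.eq_repr_basis_left b z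
  have hc : ∀ i, c i = 0 := fun i => by
    ext x
    have := hz ((b.coord i).smulRight x)
    rw [Finsupp.sum_fintype _ _ (by simp), dualPairing, bidualPairing_sum] at this
    simp only [bidualPairing_tmul, LinearMap.comp_apply,
      LinearMap.smulRight_apply, map_smul, Module.Basis.coord_apply, Module.Basis.repr_self] at this
    rw [Finset.sum_eq_single i (fun j _ hj => by simp [hj]) (by simp)] at this
    simpa using (Bidual.eval_canon x (c i)).symm.trans (by simpa using this)
  have : c = 0 := Finsupp.ext hc
  simp [this]

/-- A functional on the maps `E → C` that is dominated by `v ↦ ‖(Id ⊗ v)(t)‖_max` is given by some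
`z ∈ E ⊗ C*`, and `z` is dominated in the same way on the maps `E → C**`. -/
theorem exists_dualPairing_eq {D : Type u} [NonUnitalCStarAlgebra D] (t : D ⊗[ℂ] E)
    (f : (E →ₗ[ℂ] C) →ₗ[ℂ] ℂ) (hf : ∀ v, ‖f v‖ₑ ≤ maxTensorNorm (v.lTensor D t)) :
    ∃ z : E ⊗[ℂ] StrongDual ℂ C, (∀ v, f v = dualPairing z v) ∧
      ∀ w : E →ₗ[ℂ] Bidual C, ‖bidualPairing z w‖ₑ ≤ maxTensorNorm (w.lTensor D t) := by
  obtain ⟨H, i1, i2, i3, π, σ, hc, hmax⟩ := exists_rep_maxTensorNorm D C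
  obtain ⟨K, j1, j2, j3, R, ξ, η, hξ, hη, hR⟩ := exists_rep_of_norm_le
    (prodRep π σ ∘ₗ LinearMap.applyₗ t ∘ₗ LinearMap.lTensorHom D) f (fun v => by
      have := hf v
      rw [hmax, enorm_le_iff_norm_le] at this
      exact this)
  -- the element of `E ⊗ C*` obtained from `t` by `d ⊗ e ↦ e ⊗ ⟨π(d)* η, σ(·) ξ⟩`
  let G : D →ₗ[ℂ] StrongDual ℂ C :=
    { toFun := fun d => coeffFunctional (R.comp σ) (star (R (π d)) η) ξ
      map_add' := fun d d' => by
        ext c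
        simp [coeffFunctional_apply, ContinuousLinearMap.star_eq_adjoint]
      map_smul' := fun a d => by
        ext c
        simp [coeffFunctional_apply, ContinuousLinearMap.star_eq_adjoint, mul_comm] }
  have hG : ∀ (s : D ⊗[ℂ] E) (w : E →ₗ[ℂ] Bidual C),
      bidualPairing (TensorProduct.comm ℂ _ _ (G.rTensor E s)) w =
      inner ℂ η (prodRep (R.comp π) (normalExtension (R.comp σ)) (w.lTensor D s) ξ) := by
    intro s w
    induction s with
    | zero => simp [bidualPairing_zero]
    | tmul d e =>
      rw [LinearMap.rTensor_tmul, TensorProduct.comm_tmul, bidualPairing_tmul,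
        LinearMap.lTensor_tmul, prodRep_tmul, mul_apply_eq_comp,
        ← ContinuousLinearMap.adjoint_inner_left, inner_normalExtension]
      rfl
    | add x y hx hy => simp only [map_add, bidualPairing_add, hx, hy, add_apply, inner_add_right]
  have hG' : ∀ (s : D ⊗[ℂ] E) (v : E →ₗ[ℂ] C),
      dualPairing (TensorProduct.comm ℂ _ _ (G.rTensor E s)) v =
      inner ℂ η (prodRep (R.comp π) (R.comp σ) (v.lTensor D s) ξ) := by
    intro s v
    induction s with
    | zero => simp [dualPairing, bidualPairing_zero]
    | tmul d e =>
      rw [LinearMap.rTensor_tmul, TensorProduct.comm_tmul, dualPairing_tmul,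
        LinearMap.lTensor_tmul, prodRep_tmul, mul_apply_eq_comp,
        ← ContinuousLinearMap.adjoint_inner_left]
      rfl
    | add x y hx hy =>
      simp only [dualPairing] at hx hy ⊢
      simp only [map_add, bidualPairing_add, hx, hy, add_apply, inner_add_right]
  refine ⟨TensorProduct.comm ℂ _ _ (G.rTensor E t), fun v => ?_, fun w => ?_⟩
  · rw [hG', hR, prodRep_comp]
    rfl
  · rw [hG]
    refine le_trans ?_ (enorm_prodRep_le_maxTensorNorm (R.comp π) (normalExtension (R.comp σ))
      (fun d F => commute_normalExtension _ _ (fun c => (hc d c).map R) F) _)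
    rw [enorm_le_iff_norm_le]
    calc _ ≤ ‖η‖ * (‖prodRep (R.comp π) (normalExtension (R.comp σ)) (w.lTensor D t)‖ * ‖ξ‖) :=
          (norm_inner_le_norm _ _).trans (by gcongr; exact ContinuousLinearMap.le_opNorm _ _)
      _ ≤ 1 * (‖prodRep (R.comp π) (normalExtension (R.comp σ)) (w.lTensor D t)‖ * 1) := by
          gcongr
      _ = _ := by ring

end Pairing

/-! ### The minimal norm: jointly faithful families and slice maps -/

/-- Jointly injective *-homomorphisms of a C*-algebra compute its norm. -/
theorem norm_le_of_forall_norm_apply_le {B : Type*} [NonUnitalCStarAlgebra B] {I : Type*}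
    {M : I → Type*} [∀ i, NonUnitalCStarAlgebra (M i)] (σ : ∀ i, B →⋆ₙₐ[ℂ] M i)
    (hσ : ∀ b, (∀ i, σ i b = 0) → b = 0) {b : B} {r : ℝ} (hr : 0 ≤ r) (h : ∀ i, ‖σ i b‖ ≤ r) :
    ‖b‖ ≤ r := by
  let Ψ : B →⋆ₙₐ[ℂ] lp M ∞ :=
    { toFun := fun y => ⟨fun i => σ i y, memℓp_infty ⟨‖y‖, by
        rintro _ ⟨i, rfl⟩
        exact NonUnitalStarAlgHom.norm_apply_le (σ i) y⟩⟩
      map_smul' := fun c y => by ext1; funext i; exact map_smul (σ i) c y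
      map_zero' := by ext1; funext i; exact map_zero (σ i)
      map_add' := fun y z => by ext1; funext i; exact map_add (σ i) y z
      map_mul' := fun y z => by ext1; funext i; exact map_mul (σ i) y z
      map_star' := fun y => by ext1; funext i; exact map_star (σ i) y }
  have hinj : Function.Injective Ψ :=
    (injective_iff_map_eq_zero _).2 fun y hy => hσ _ fun i => congrArg (fun f => f.1 i) hy
  rw [← NonUnitalStarAlgHom.norm_map Ψ hinj b]
  exact lp.norm_le_of_forall_le hr h

theorem norm_inner_self_eq {X : Type*} [NormedAddCommGroup X] [InnerProductSpace ℂ X] (x : X) :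
    ‖(inner ℂ x x : ℂ)‖ = ‖x‖ * ‖x‖ := by
  rw [inner_self_eq_norm_sq_to_K]
  simp [sq]

section MatrixRep

variable {D : Type u} [NonUnitalCStarAlgebra D] {n : Type} [Fintype n] [DecidableEq n]
  {H : Type u} [NormedAddCommGroup H] [InnerProductSpace ℂ H]

theorem sum_sum_matUnit_apply (x : n → n → (H →L[ℂ] H)) (u : PiLp 2 (fun _ : n => H)) (k : n) :
    (∑ i, ∑ j, matUnit i j (x i j)) u k = ∑ j, x k j (u j) := by
  simp [matUnit_apply]

variable [CompleteSpace H]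

/-- The amplification of a representation of `D` on `H` to a representation of `M_n(D)` on `Hⁿ`. -/
noncomputable def matrixRep (n : Type) [Fintype n] [DecidableEq n] (π : D →⋆ₙₐ[ℂ] (H →L[ℂ] H)) :
    CStarMatrix n n D →⋆ₙₐ[ℂ] (PiLp 2 (fun _ : n => H) →L[ℂ] PiLp 2 (fun _ : n => H)) where
  toFun x := ∑ i, ∑ j, matUnit i j (π (x i j))
  map_smul' c x := by
    ext u k
    rw [sum_sum_matUnit_apply]
    change _ = c • (∑ i, ∑ j, matUnit i j (π (x i j))) u k
    rw [sum_sum_matUnit_apply]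
    simp only [CStarMatrix.smul_apply, map_smul, smul_apply, Finset.smul_sum]
  map_zero' := by
    ext u k
    rw [sum_sum_matUnit_apply]
    simp
  map_add' x y := by
    ext u k
    rw [sum_sum_matUnit_apply]
    simp only [CStarMatrix.add_apply, map_add, add_apply, PiLp.add_apply,
      sum_sum_matUnit_apply, Finset.sum_add_distrib]
  map_mul' x y := by
    ext u k
    rw [sum_sum_matUnit_apply, mul_apply_eq_comp, sum_sum_matUnit_apply]
    simp only [sum_sum_matUnit_apply _ u]
    simp only [CStarMatrix.mul_apply, map_sum, map_mul, sum_apply, mul_apply_eq_comp]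
    exact Finset.sum_comm
  map_star' x := by
    refine (ContinuousLinearMap.eq_adjoint_iff _ _).2 fun u v => ?_
    rw [PiLp.inner_apply, PiLp.inner_apply]
    simp only [sum_sum_matUnit_apply, sum_inner, inner_sum]
    rw [Finset.sum_comm]
    refine Finset.sum_congr rfl fun i _ => Finset.sum_congr rfl fun j _ => ?_
    rw [CStarMatrix.star_apply, map_star, ContinuousLinearMap.star_eq_adjoint,
      ContinuousLinearMap.adjoint_inner_left]

theorem matrixRep_apply (π : D →⋆ₙₐ[ℂ] (H →L[ℂ] H)) (x : CStarMatrix n n D)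
    (u : PiLp 2 (fun _ : n => H)) (k : n) : matrixRep n π x u k = ∑ j, π (x k j) (u j) :=
  sum_sum_matUnit_apply _ u k

theorem eq_zero_of_matrixRep_eq_zero {π : D →⋆ₙₐ[ℂ] (H →L[ℂ] H)} {x : CStarMatrix n n D}
    (h : matrixRep n π x = 0) (i j : n) : π (x i j) = 0 := by
  ext ξ
  have := congrArg (fun T => T (WithLp.toLp 2 (Pi.single j ξ)) i) h
  simp only [matrixRep_apply] at this
  rw [Finset.sum_eq_single j (fun k _ hk => by simp [hk]) (by simp)] at this
  simpa using this

/-- A jointly faithful family of representations of `D` dominates every other one on matrices over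
`D`, because its amplifications are jointly faithful on the C*-algebra `M_n(D)`. -/
theorem norm_matrixRep_le_of_forall_le {I : Type*} {L : I → Type u}
    [∀ i, NormedAddCommGroup (L i)] [∀ i, InnerProductSpace ℂ (L i)] [∀ i, CompleteSpace (L i)]
    (σ : ∀ i, D →⋆ₙₐ[ℂ] (L i →L[ℂ] L i)) (hσ : ∀ d, (∀ i, σ i d = 0) → d = 0)
    (π : D →⋆ₙₐ[ℂ] (H →L[ℂ] H)) (x : CStarMatrix n n D) {r : ℝ} (hr : 0 ≤ r)
    (h : ∀ i, ‖matrixRep n (σ i) x‖ ≤ r) : ‖matrixRep n π x‖ ≤ r := by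
  let _ := CStarAlgebra.spectralOrder D
  let _ := CStarAlgebra.spectralOrderedRing D
  refine (NonUnitalStarAlgHom.norm_apply_le _ x).trans
    (norm_le_of_forall_norm_apply_le (fun i => matrixRep n (σ i)) (fun y hy => ?_) hr h)
  ext j k
  exact hσ _ fun i => eq_zero_of_matrixRep_eq_zero (hy i) j k

end MatrixRep

section Slice

variable {D : Type u} [NonUnitalCStarAlgebra D] {V W : Type*} [AddCommGroup V] [Module ℂ V]
  [AddCommGroup W] [Module ℂ W]

/-- The slice map `Id ⊗ φ : D ⊗ V → D`. -/
noncomputable def sliceMap (D : Type u) [NonUnitalCStarAlgebra D] (φ : V →ₗ[ℂ] ℂ) :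
    D ⊗[ℂ] V →ₗ[ℂ] D :=
  (TensorProduct.rid ℂ D).toLinearMap ∘ₗ φ.lTensor D

theorem sliceMap_tmul (φ : V →ₗ[ℂ] ℂ) (d : D) (a : V) : sliceMap D φ (d ⊗ₜ a) = φ a • d := by
  simp [sliceMap]

theorem sliceMap_lTensor (φ : W →ₗ[ℂ] ℂ) (f : V →ₗ[ℂ] W) (t : D ⊗[ℂ] V) :
    sliceMap D φ (f.lTensor D t) = sliceMap D (φ ∘ₗ f) t := by
  simp [sliceMap, LinearMap.lTensor_comp]

end Slice

section SumTmul

variable {H K : Type u} [NormedAddCommGroup H] [InnerProductSpace ℂ H]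
  [NormedAddCommGroup K] [InnerProductSpace ℂ K]

/-- `h ↦ ∑ h_i ⊗ g_i`. -/
noncomputable def sumTmul {n : Type} [Fintype n] (H : Type u) [NormedAddCommGroup H]
    [InnerProductSpace ℂ H] (g : n → K) (h : PiLp 2 (fun _ : n => H)) : H ⊗[ℂ] K :=
  ∑ i, h i ⊗ₜ g i

theorem norm_sumTmul {n : Type} [Fintype n] {g : n → K} (hg : Orthonormal ℂ g)
    (h : PiLp 2 (fun _ : n => H)) : ‖sumTmul H g h‖ = ‖h‖ := by
  classical
  have h1 : inner ℂ (sumTmul H g h) (sumTmul H g h) = inner ℂ h h := by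
    simp only [sumTmul, sum_inner, inner_sum, TensorProduct.inner_tmul, PiLp.inner_apply,
      orthonormal_iff_ite.1 hg]
    simp
  rw [← sq_eq_sq₀ (norm_nonneg _) (norm_nonneg _), ← inner_self_eq_norm_sq (𝕜 := ℂ),
    ← inner_self_eq_norm_sq (𝕜 := ℂ), h1]

theorem exists_orthonormal_sumTmul (u v : H ⊗[ℂ] K) :
    ∃ (m : ℕ) (g : Fin m → K), Orthonormal ℂ g ∧
      ∃ h k : PiLp 2 (fun _ : Fin m => H), u = sumTmul H g h ∧ v = sumTmul H g k := by
  obtain ⟨W, hW, hs⟩ := TensorProduct.exists_finite_submodule_right_of_setFinite {u, v} (by simp)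
  let b := stdOrthonormalBasis ℂ W
  have key : ∀ x ∈ ({u, v} : Set (H ⊗[ℂ] K)), ∃ h : PiLp 2 (fun _ : Fin (Module.finrank ℂ W) => H),
      x = sumTmul H (fun i => (b i : K)) h := by
    intro x hx
    obtain ⟨y, rfl⟩ := hs hx
    obtain ⟨c, rfl⟩ := TensorProduct.eq_repr_basis_right b.toBasis y
    refine ⟨WithLp.toLp 2 c, ?_⟩
    rw [Finsupp.sum_fintype _ _ (by simp), map_sum]
    simp [sumTmul]
  obtain ⟨h, hh⟩ := key u (by simp)
  obtain ⟨k, hk⟩ := key v (by simp)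
  exact ⟨_, _, b.orthonormal.comp_linearIsometry W.subtypeₗᵢ, h, k, hh, hk⟩

end SumTmul

section MinNorm

variable {D A H K : Type u} [NonUnitalCStarAlgebra D] [NonUnitalCStarAlgebra A]
  [NormedAddCommGroup H] [InnerProductSpace ℂ H] [CompleteSpace H]
  [NormedAddCommGroup K] [InnerProductSpace ℂ K] [CompleteSpace K]

theorem tensorRep_tmul (π : D →⋆ₙₐ[ℂ] (H →L[ℂ] H)) (ρ : A →⋆ₙₐ[ℂ] (K →L[ℂ] K)) (d : D) (a : A) :
    tensorRep π ρ (d ⊗ₜ a) = TensorProduct.mapL (π d) (ρ a) := rfl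

theorem tensorRep_tmul_apply_tmul (π : D →⋆ₙₐ[ℂ] (H →L[ℂ] H)) (ρ : A →⋆ₙₐ[ℂ] (K →L[ℂ] K)) (d : D)
    (a : A) (h : H) (k : K) : tensorRep π ρ (d ⊗ₜ a) (h ⊗ₜ k) = π d h ⊗ₜ ρ a k := rfl

theorem enorm_tensorRep_le_minTensorNorm (π : D →⋆ₙₐ[ℂ] (H →L[ℂ] H))
    (ρ : A →⋆ₙₐ[ℂ] (K →L[ℂ] K)) (t : D ⊗[ℂ] A) : ‖tensorRep π ρ t‖ₑ ≤ minTensorNorm t := by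
  unfold minTensorNorm
  refine le_iSup_of_le H <| le_iSup_of_le _ <| le_iSup_of_le _ <| le_iSup_of_le _ <|
    le_iSup_of_le K <| le_iSup_of_le _ <| le_iSup_of_le _ <| le_iSup_of_le _ <|
    le_iSup_of_le π <| le_iSup_of_le ρ le_rfl

theorem inner_tmul_tensorRep_tmul (π : D →⋆ₙₐ[ℂ] (H →L[ℂ] H)) (ρ : A →⋆ₙₐ[ℂ] (K →L[ℂ] K))
    (t : D ⊗[ℂ] A) (h h' : H) (k k' : K) :
    inner ℂ (h' ⊗ₜ[ℂ] k') (tensorRep π ρ t (h ⊗ₜ k)) =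
      inner ℂ h' (π (sliceMap D (coeffFunctional ρ k' k).toLinearMap t) h) := by
  induction t with
  | zero => simp
  | tmul d a =>
    rw [tensorRep_tmul_apply_tmul, TensorProduct.inner_tmul, sliceMap_tmul, map_smul, smul_apply,
      inner_smul_right, mul_comm]
    rfl
  | add x y hx hy => simp only [map_add, add_apply, inner_add_right, hx, hy]

theorem tensorRep_comp {D' : Type u} [NonUnitalCStarAlgebra D'] (p : D →⋆ₙₐ[ℂ] D')
    (π : D' →⋆ₙₐ[ℂ] (H →L[ℂ] H)) (ρ : A →⋆ₙₐ[ℂ] (K →L[ℂ] K)) (t : D ⊗[ℂ] A) :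
    tensorRep (π.comp p) ρ t = tensorRep π ρ ((p : D →ₗ[ℂ] D').rTensor A t) := by
  induction t with
  | zero => simp
  | tmul d a => rfl
  | add x y hx hy => simp only [map_add, hx, hy]

/-- The compression `((Id ⊗ ⟨g_i, ρ(·) g_j⟩)(t))_ij` of `t ∈ D ⊗ A` to the span of the vectors
`g_i`. -/
noncomputable def sliceMatrix {n : Type} (ρ : A →⋆ₙₐ[ℂ] (K →L[ℂ] K)) (g : n → K) (t : D ⊗[ℂ] A) :
    CStarMatrix n n D :=
  CStarMatrix.ofMatrix fun i j => sliceMap D (coeffFunctional ρ (g i) (g j)).toLinearMap t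

/-- On the vectors `∑ h_i ⊗ g_i`, the operator `(π ⊗ ρ)(t)` acts through the compressed matrix. -/
theorem inner_sumTmul_tensorRep {n : Type} [Fintype n] [DecidableEq n]
    (π : D →⋆ₙₐ[ℂ] (H →L[ℂ] H)) (ρ : A →⋆ₙₐ[ℂ] (K →L[ℂ] K)) (g : n → K) (t : D ⊗[ℂ] A)
    (h h' : PiLp 2 (fun _ : n => H)) :
    inner ℂ (sumTmul H g h') (tensorRep π ρ t (sumTmul H g h)) =
      inner ℂ h' (matrixRep n π (sliceMatrix ρ g t) h) := by
  simp only [sumTmul, map_sum, sum_inner, inner_sum, inner_tmul_tensorRep_tmul, PiLp.inner_apply,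
    matrixRep_apply]
  rw [Finset.sum_comm]
  rfl

/-- The spatial norm may be computed with any jointly faithful family of representations of `D`.
Every vector of `H ⊗ K` lies in `H ⊗ W` with `W` finite-dimensional, and compression to `W` turns
the tensor into a matrix over `D`. -/
theorem norm_tensorRep_le_of_forall_le {I : Type*} {L : I → Type u}
    [∀ i, NormedAddCommGroup (L i)] [∀ i, InnerProductSpace ℂ (L i)] [∀ i, CompleteSpace (L i)]
    (σ : ∀ i, D →⋆ₙₐ[ℂ] (L i →L[ℂ] L i)) (hσ : ∀ d, (∀ i, σ i d = 0) → d = 0)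
    (π : D →⋆ₙₐ[ℂ] (H →L[ℂ] H)) (ρ : A →⋆ₙₐ[ℂ] (K →L[ℂ] K)) (t : D ⊗[ℂ] A) {r : ℝ} (hr : 0 ≤ r)
    (h : ∀ i, ‖tensorRep (σ i) ρ t‖ ≤ r) : ‖tensorRep π ρ t‖ ≤ r := by
  have hle : ∀ {X : Type u} [NormedAddCommGroup X] [InnerProductSpace ℂ X] (x y : X) (S : X →L[ℂ] X),
      ‖inner ℂ x (S y)‖ ≤ ‖S‖ * ‖x‖ * ‖y‖ := fun x y S => by
    calc _ ≤ ‖x‖ * (‖S‖ * ‖y‖) :=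
          (norm_inner_le_norm _ _).trans (by gcongr; exact S.le_opNorm y)
      _ = _ := by ring
  have hof : ∀ {X : Type u} [NormedAddCommGroup X] [InnerProductSpace ℂ X] (S : X →L[ℂ] X),
      (∀ x y, ‖inner ℂ x (S y)‖ ≤ r * ‖x‖ * ‖y‖) → ‖S‖ ≤ r := fun S hS => by
    refine S.opNorm_le_bound hr fun y => ?_
    have h1 := hS (S y) y
    rw [norm_inner_self_eq] at h1
    by_cases h0 : ‖S y‖ = 0
    · rw [h0]; positivity
    · have : 0 < ‖S y‖ := lt_of_le_of_ne (norm_nonneg _) (Ne.symm h0)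
      nlinarith
  refine hof _ fun u v => ?_
  obtain ⟨m, g, hg, x, y, rfl, rfl⟩ := exists_orthonormal_sumTmul u v
  rw [inner_sumTmul_tensorRep, norm_sumTmul hg, norm_sumTmul hg]
  refine (hle _ _ _).trans ?_
  gcongr
  refine norm_matrixRep_le_of_forall_le σ hσ π _ hr fun i => hof _ fun x y => ?_
  rw [← inner_sumTmul_tensorRep]
  refine (hle _ _ _).trans ?_
  rw [norm_sumTmul hg, norm_sumTmul hg]
  gcongr
  exact h i

/-- A jointly injective family of *-homomorphisms of `D` computes the minimal norm of `D ⊗ A`. -/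
theorem minTensorNorm_le_of_forall_le {I : Type*} {D' : I → Type u}
    [∀ i, NonUnitalCStarAlgebra (D' i)] (p : ∀ i, D →⋆ₙₐ[ℂ] D' i)
    (hp : ∀ d, (∀ i, p i d = 0) → d = 0) (t : D ⊗[ℂ] A) {r : ℝ≥0}
    (h : ∀ i, minTensorNorm ((p i : D →ₗ[ℂ] D' i).rTensor A t) ≤ r) : minTensorNorm t ≤ r := by
  choose L i1 i2 i3 σ hσ using fun i => exists_injective_rep (D' i)
  unfold minTensorNorm
  simp only [iSup_le_iff]
  intro H _ _ _ K _ _ _ π ρ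
  rw [enorm_le_coe]
  refine norm_tensorRep_le_of_forall_le (fun i => (σ i).comp (p i)) (fun d hd => hp d fun i => ?_)
    π ρ t r.2 fun i => ?_
  · exact hσ i ((hd i).trans (map_zero (σ i)).symm)
  · rw [tensorRep_comp]
    exact enorm_le_coe.1 ((enorm_tensorRep_le_minTensorNorm _ _ _).trans (h i))

/-- Slice maps `Id ⊗ φ` on `D ⊗_min E` are bounded, uniformly in `D`. The functionals `φ` with this
property form a subspace of the dual of `E`, which contains all coefficients of a faithful
representation of `A` and hence separates the points of `E`. -/
theorem exists_enorm_sliceMap_le (E : Submodule ℂ A) [FiniteDimensional ℂ E] (φ : E →ₗ[ℂ] ℂ) :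
    ∃ c : ℝ≥0, ∀ (D : Type u) [NonUnitalCStarAlgebra D] (t : D ⊗[ℂ] E),
      ‖sliceMap D φ t‖ₑ ≤ c * minTensorNorm (E.subtype.lTensor D t) := by
  let S : Submodule ℂ (Module.Dual ℂ E) :=
    { carrier := {φ | ∃ c : ℝ≥0, ∀ (D : Type u) [NonUnitalCStarAlgebra D] (t : D ⊗[ℂ] E),
        ‖sliceMap D φ t‖ₑ ≤ c * minTensorNorm (E.subtype.lTensor D t)}
      zero_mem' := ⟨0, fun D _ t => by simp [sliceMap]⟩
      add_mem' := by
        rintro φ ψ ⟨c, hc⟩ ⟨c', hc'⟩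
        refine ⟨c + c', fun D _ t => ?_⟩
        have : sliceMap D (φ + ψ) t = sliceMap D φ t + sliceMap D ψ t := by
          simp [sliceMap, LinearMap.lTensor_add]
        rw [this, ENNReal.coe_add, add_mul]
        exact (enorm_add_le _ _).trans (add_le_add (hc D t) (hc' D t))
      smul_mem' := by
        rintro a φ ⟨c, hc⟩
        refine ⟨‖a‖₊ * c, fun D _ t => ?_⟩
        have : sliceMap D (a • φ) t = a • sliceMap D φ t := by
          simp [sliceMap, LinearMap.lTensor_smul]
        rw [this, enorm_smul, ENNReal.coe_mul, mul_assoc]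
        exact mul_le_mul_right (hc D t) _ }
  suffices hS : S = ⊤ from (hS.symm ▸ Submodule.mem_top : φ ∈ S)
  obtain ⟨K, i1, i2, i3, ρ, hρ⟩ := exists_injective_rep A
  have hmem : ∀ η ξ : K, (coeffFunctional ρ η ξ).toLinearMap ∘ₗ E.subtype ∈ S := by
    intro η ξ
    refine ⟨‖η‖₊ * ‖ξ‖₊, fun D _ t => ?_⟩
    obtain ⟨H, j1, j2, j3, π, hπ⟩ := exists_injective_rep D
    rw [← sliceMap_lTensor]
    refine le_trans ?_ (mul_le_mul_right (enorm_tensorRep_le_minTensorNorm π ρ _) _)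
    generalize E.subtype.lTensor D t = s
    rw [← ofReal_norm, ← ofReal_norm, ← NonUnitalStarAlgHom.norm_map π hπ, ← ENNReal.ofReal_coe_nnreal,
      ← ENNReal.ofReal_mul (by positivity)]
    refine ENNReal.ofReal_le_ofReal (ContinuousLinearMap.opNorm_le_bound _ (by positivity) fun h => ?_)
    set x := π (sliceMap D (coeffFunctional ρ η ξ).toLinearMap s) h with hx
    by_cases h0 : ‖x‖ = 0
    · rw [h0]; positivity
    have hpos : 0 < ‖x‖ := lt_of_le_of_ne (norm_nonneg _) (Ne.symm h0)
    have h1 : ‖x‖ * ‖x‖ ≤ (‖x‖ * ‖η‖) * (‖tensorRep π ρ s‖ * (‖h‖ * ‖ξ‖)) := by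
      rw [← norm_inner_self_eq x]
      nth_rw 2 [hx]
      rw [← inner_tmul_tensorRep_tmul]
      refine (norm_inner_le_norm (𝕜 := ℂ) (E := H ⊗[ℂ] K) _ _).trans ?_
      rw [TensorProduct.norm_tmul,
        ← show ‖h ⊗ₜ[ℂ] ξ‖ = ‖h‖ * ‖ξ‖ by rw [TensorProduct.norm_tmul]]
      gcongr
      exact ContinuousLinearMap.le_opNorm _ _
    have h2 : ‖x‖ * ‖x‖ ≤ ‖x‖ * (‖η‖ * ‖ξ‖ * ‖tensorRep π ρ s‖ * ‖h‖) := by linarith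
    simpa using le_of_mul_le_mul_left h2 hpos
  have hbot : S.dualCoannihilator = ⊥ := by
    rw [eq_bot_iff]
    intro e he
    rw [Submodule.mem_dualCoannihilator] at he
    have h0 : ρ (e : A) = 0 := ContinuousLinearMap.ext fun ξ => ext_inner_left ℂ fun η => by
      simpa [coeffFunctional_apply] using he _ (hmem η ξ)
    have h1 : (e : A) = 0 := hρ (h0.trans (map_zero ρ).symm)
    simpa using h1
  rw [← Subspace.dualCoannihilator_dualAnnihilator_eq (W := S), hbot,
    Submodule.dualAnnihilator_bot]

end MinNorm

/-! ### Norms of elementary tensors -/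

section TensorHilbert

open UniformSpace

variable {H K : Type u} [NormedAddCommGroup H] [InnerProductSpace ℂ H]
  [NormedAddCommGroup K] [InnerProductSpace ℂ K]

/-- The operator `x ⊗ y` on the Hilbert space completion of `H ⊗ K`. -/
noncomputable def tensorOp (x : H →L[ℂ] H) (y : K →L[ℂ] K) :
    Completion (H ⊗[ℂ] K) →L[ℂ] Completion (H ⊗[ℂ] K) :=
  (TensorProduct.mapL x y).completion

theorem tensorOp_coe (x : H →L[ℂ] H) (y : K →L[ℂ] K) (u : H ⊗[ℂ] K) :
    tensorOp x y (u : Completion (H ⊗[ℂ] K)) = (TensorProduct.mapL x y u : H ⊗[ℂ] K) := by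
  simp [tensorOp]

theorem tensorOp_ext {S T : Completion (H ⊗[ℂ] K) →L[ℂ] Completion (H ⊗[ℂ] K)}
    (h : ∀ u : H ⊗[ℂ] K, S u = T u) : S = T := by
  ext a
  induction a using Completion.induction_on with
  | hp => exact isClosed_eq S.continuous T.continuous
  | ih a => exact h a

theorem tensorOp_mul (x x' : H →L[ℂ] H) (y y' : K →L[ℂ] K) :
    tensorOp (x * x') (y * y') = tensorOp x y * tensorOp x' y' := by
  refine tensorOp_ext fun u => ?_
  rw [mul_apply_eq_comp, tensorOp_coe, tensorOp_coe, tensorOp_coe, TensorProduct.mapL_mul]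
  rfl

theorem norm_mul_norm_le_norm_tensorOp (x : H →L[ℂ] H) (y : K →L[ℂ] K) :
    ‖x‖ * ‖y‖ ≤ ‖tensorOp x y‖ := by
  have h1 : ∀ h k, ‖x h‖ * ‖y k‖ ≤ ‖tensorOp x y‖ * ‖h‖ * ‖k‖ := fun h k => by
    have := (tensorOp x y).le_opNorm ((h ⊗ₜ[ℂ] k : H ⊗[ℂ] K) : Completion (H ⊗[ℂ] K))
    rwa [tensorOp_coe, Completion.norm_coe, Completion.norm_coe, TensorProduct.mapL_tmul,
      TensorProduct.norm_tmul, TensorProduct.norm_tmul, ← mul_assoc] at this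
  have h2 : ∀ h, ‖x h‖ * ‖y‖ ≤ ‖tensorOp x y‖ * ‖h‖ := fun h => by
    have : ‖(‖x h‖ : ℂ) • y‖ ≤ ‖tensorOp x y‖ * ‖h‖ :=
      ContinuousLinearMap.opNorm_le_bound _ (by positivity) fun k => by
        simpa [norm_smul] using h1 h k
    simpa [norm_smul] using this
  have : ‖(‖y‖ : ℂ) • x‖ ≤ ‖tensorOp x y‖ :=
    ContinuousLinearMap.opNorm_le_bound _ (by positivity) fun h => by
      simpa [norm_smul, mul_comm] using h2 h
  simpa [norm_smul, mul_comm] using this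

variable [CompleteSpace H] [CompleteSpace K]

theorem inner_mapL_adjoint (x : H →L[ℂ] H) (y : K →L[ℂ] K) (u v : H ⊗[ℂ] K) :
    inner ℂ (TensorProduct.mapL (star x) (star y) u) v = inner ℂ u (TensorProduct.mapL x y v) := by
  induction u with
  | zero => simp
  | add a b ha hb => simp only [map_add, inner_add_left, ha, hb]
  | tmul h k =>
    induction v with
    | zero => simp
    | add a b ha hb => simp only [map_add, inner_add_right, ha, hb]
    | tmul h' k' =>
      rw [TensorProduct.mapL_tmul, TensorProduct.mapL_tmul, TensorProduct.inner_tmul,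
        TensorProduct.inner_tmul, ContinuousLinearMap.star_eq_adjoint,
        ContinuousLinearMap.star_eq_adjoint, ContinuousLinearMap.adjoint_inner_left,
        ContinuousLinearMap.adjoint_inner_left]

theorem star_tensorOp (x : H →L[ℂ] H) (y : K →L[ℂ] K) :
    tensorOp (star x) (star y) = star (tensorOp x y) := by
  refine (ContinuousLinearMap.eq_adjoint_iff _ _).2 fun a b => ?_
  induction a, b using Completion.induction_on₂ with
  | hp => apply isClosed_eq <;> fun_prop
  | ih a b =>
    rw [tensorOp_coe, tensorOp_coe, Completion.inner_coe, Completion.inner_coe, inner_mapL_adjoint]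

/-- The representation `x ↦ x ⊗ 1` of `B(H)` on the Hilbert space tensor product of `H` and `K`. -/
noncomputable def leftAmplification (H K : Type u) [NormedAddCommGroup H] [InnerProductSpace ℂ H]
    [CompleteSpace H] [NormedAddCommGroup K] [InnerProductSpace ℂ K] [CompleteSpace K] :
    (H →L[ℂ] H) →⋆ₙₐ[ℂ] (Completion (H ⊗[ℂ] K) →L[ℂ] Completion (H ⊗[ℂ] K)) where
  toFun x := tensorOp x 1
  map_smul' c x := tensorOp_ext fun u => by
    simp [tensorOp_coe, TensorProduct.map_smul_left]
  map_zero' := tensorOp_ext fun u => by simp [tensorOp_coe]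
  map_add' x y := tensorOp_ext fun u => by
    simp [tensorOp_coe, TensorProduct.map_add_left, Completion.coe_add]
  map_mul' x y := by rw [← tensorOp_mul, one_mul]
  map_star' x := by rw [← star_tensorOp, star_one]

/-- The representation `y ↦ 1 ⊗ y` of `B(K)` on the Hilbert space tensor product of `H` and `K`. -/
noncomputable def rightAmplification (H K : Type u) [NormedAddCommGroup H] [InnerProductSpace ℂ H]
    [CompleteSpace H] [NormedAddCommGroup K] [InnerProductSpace ℂ K] [CompleteSpace K] :
    (K →L[ℂ] K) →⋆ₙₐ[ℂ] (Completion (H ⊗[ℂ] K) →L[ℂ] Completion (H ⊗[ℂ] K)) where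
  toFun y := tensorOp 1 y
  map_smul' c x := tensorOp_ext fun u => by
    simp [tensorOp_coe, TensorProduct.map_smul_right]
  map_zero' := tensorOp_ext fun u => by simp [tensorOp_coe]
  map_add' x y := tensorOp_ext fun u => by
    simp [tensorOp_coe, TensorProduct.map_add_right, Completion.coe_add]
  map_mul' x y := by rw [← tensorOp_mul, one_mul]
  map_star' x := by rw [← star_tensorOp, star_one]

end TensorHilbert

section CrossNorm

variable {D A C : Type u} [NonUnitalCStarAlgebra D] [NonUnitalCStarAlgebra A]
  [NonUnitalCStarAlgebra C]

theorem enorm_mul_enorm_le_maxTensorNorm (d : D) (c : C) :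
    ‖d‖ₑ * ‖c‖ₑ ≤ maxTensorNorm (d ⊗ₜ[ℂ] c) := by
  obtain ⟨H, i1, i2, i3, π, hπ⟩ := exists_injective_rep D
  obtain ⟨K, j1, j2, j3, σ, hσ⟩ := exists_injective_rep C
  refine le_trans ?_ (enorm_prodRep_le_maxTensorNorm ((leftAmplification H K).comp π)
    ((rightAmplification H K).comp σ) (fun d c => ?_) (d ⊗ₜ c))
  · rw [prodRep_tmul, show ((leftAmplification H K).comp π) d * ((rightAmplification H K).comp σ) c =
      tensorOp (π d) (σ c) from by
        rw [← mul_one (π d), ← one_mul (σ c), tensorOp_mul]; simp; rfl]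
    rw [← ofReal_norm, ← ofReal_norm, ← ofReal_norm, ← ENNReal.ofReal_mul (norm_nonneg _)]
    refine ENNReal.ofReal_le_ofReal ?_
    rw [← NonUnitalStarAlgHom.norm_map π hπ, ← NonUnitalStarAlgHom.norm_map σ hσ]
    exact norm_mul_norm_le_norm_tensorOp _ _
  · change tensorOp (π d) 1 * tensorOp 1 (σ c) = tensorOp 1 (σ c) * tensorOp (π d) 1
    rw [← tensorOp_mul, ← tensorOp_mul, mul_one, one_mul, mul_one, one_mul]

theorem minTensorNorm_tmul_le (d : D) (a : A) : minTensorNorm (d ⊗ₜ[ℂ] a) ≤ ‖d‖ₑ * ‖a‖ₑ := by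
  unfold minTensorNorm
  simp only [iSup_le_iff]
  intro H _ _ _ K _ _ _ π ρ
  rw [tensorRep_tmul, ← ofReal_norm, ← ofReal_norm, ← ofReal_norm,
    ← ENNReal.ofReal_mul (norm_nonneg _)]
  refine ENNReal.ofReal_le_ofReal ((TensorProduct.norm_mapL_le _ _).trans ?_)
  gcongr
  · exact NonUnitalStarAlgHom.norm_apply_le π d
  · exact NonUnitalStarAlgHom.norm_apply_le ρ a

theorem maxTensorNorm_le_minMaxNorm {B : Type u} [NonUnitalRing B] [Module ℂ B] [Star B]
    {E : Submodule ℂ A} (w : E →ₗ[ℂ] B) {t : D ⊗[ℂ] E}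
    (ht : minTensorNorm (E.subtype.lTensor D t) ≤ 1) :
    maxTensorNorm (w.lTensor D t) ≤ minMaxNorm D w :=
  le_iSup₂_of_le t ht le_rfl

theorem exists_enorm_apply_le_minMaxNorm (D : Type u) [NonUnitalCStarAlgebra D] [Nontrivial D]
    {E : Submodule ℂ A} (e : E) :
    ∃ M : ℝ≥0, ∀ v : E →ₗ[ℂ] C, ‖v e‖ₑ ≤ M * minMaxNorm D v := by
  obtain ⟨r, hr0, hr⟩ : ∃ r : ℝ≥0, r ≠ 0 ∧ ‖e‖₊ ≤ r := ⟨‖e‖₊ + 1, by positivity, le_self_add⟩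
  obtain ⟨d, hd⟩ : ∃ d : D, ‖d‖ = ((r⁻¹ : ℝ≥0) : ℝ) := exists_norm_eq D (NNReal.coe_nonneg _)
  have h1 : (r : ℝ≥0∞) * ‖d‖ₑ = 1 := by
    rw [← ofReal_norm, hd, ENNReal.ofReal_coe_nnreal, ← ENNReal.coe_mul, mul_inv_cancel₀ hr0,
      ENNReal.coe_one]
  have h2 : minTensorNorm (E.subtype.lTensor D (d ⊗ₜ e)) ≤ 1 := by
    rw [LinearMap.lTensor_tmul, ← h1, mul_comm (r : ℝ≥0∞)]
    refine (minTensorNorm_tmul_le _ _).trans (mul_le_mul_right ?_ _)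
    exact ENNReal.coe_le_coe.2 hr
  refine ⟨r, fun v => ?_⟩
  have h3 := maxTensorNorm_le_minMaxNorm v h2
  rw [LinearMap.lTensor_tmul] at h3
  have h4 := (enorm_mul_enorm_le_maxTensorNorm d (v e)).trans h3
  calc ‖v e‖ₑ = r * (‖d‖ₑ * ‖v e‖ₑ) := by rw [← mul_assoc, h1, one_mul]
    _ ≤ r * minMaxNorm D v := mul_le_mul_right h4 _

theorem isBoundedFunctional_dualPairing {E : Submodule ℂ A} {N : (E →ₗ[ℂ] C) → ℝ≥0∞}
    (hN : ∀ e : E, ∃ M : ℝ≥0, ∀ v, ‖v e‖ₑ ≤ M * N v) (z : E ⊗[ℂ] StrongDual ℂ C) :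
    IsBoundedFunctional N (dualPairing z) := by
  induction z with
  | zero => exact ⟨0, fun v => by simp [dualPairing, bidualPairing_zero]⟩
  | tmul e φ =>
    obtain ⟨M, hM⟩ := hN e
    refine ⟨‖φ‖₊ * M, fun v => ?_⟩
    rw [dualPairing_tmul, ENNReal.coe_mul, mul_assoc]
    exact (φ.le_opENorm (v e)).trans (mul_le_mul_right (hM v) _)
  | add x y hx hy =>
    obtain ⟨M, hM⟩ := hx
    obtain ⟨M', hM'⟩ := hy
    refine ⟨M + M', fun v => ?_⟩
    rw [dualPairing, bidualPairing_add, ENNReal.coe_add, add_mul]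
    exact (enorm_add_le _ _).trans (add_le_add (hM v) (hM' v))

end CrossNorm

/-! ### Consequences of a norming tensor -/

/-- A bound for the real part of a linear functional on the unit ball of the seminorm `v ↦ ‖T v‖`
bounds the functional by this seminorm. -/
theorem norm_le_mul_norm_of_re_le {V M : Type*} [AddCommGroup V] [Module ℂ V]
    [NormedAddCommGroup M] [NormedSpace ℂ M] (T : V →ₗ[ℂ] M) (f : V →ₗ[ℂ] ℂ) {r : ℝ}
    (hr : 0 ≤ r) (h : ∀ v, ‖T v‖ ≤ 1 → (f v).re ≤ r) (v : V) : ‖f v‖ ≤ r * ‖T v‖ := by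
  obtain ⟨c, hc, hc'⟩ : ∃ c : ℂ, ‖c‖ = 1 ∧ c * f v = ‖f v‖ := by
    by_cases h0 : f v = 0
    · exact ⟨1, by simp, by simp [h0]⟩
    · refine ⟨‖f v‖ / f v, by simp [h0], div_mul_cancel₀ _ h0⟩
  have key : ∀ s : ℝ, ‖T v‖ < s → ‖f v‖ ≤ r * s := fun s hs => by
    have hs0 : 0 < s := (norm_nonneg _).trans_lt hs
    have h1 := h (((s⁻¹ : ℝ) * c : ℂ) • v) (by
      rw [map_smul, norm_smul, norm_mul, hc, Complex.norm_real, norm_inv, Real.norm_of_nonneg hs0.le,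
        mul_one, inv_mul_le_iff₀ hs0, mul_one]
      exact hs.le)
    rw [map_smul, smul_eq_mul, mul_assoc, hc', ← Complex.ofReal_mul, Complex.ofReal_re,
      inv_mul_le_iff₀ hs0] at h1
    linarith
  refine le_of_forall_pos_le_add fun ε hε => ?_
  have h2 := key (‖T v‖ + ε / (r + 1)) (by linarith [show 0 < ε / (r + 1) by positivity])
  refine h2.trans ?_
  rw [mul_add]
  gcongr
  rw [mul_div_assoc', div_le_iff₀ (by positivity)]
  nlinarith

theorem norm_ofReal_nnreal (r : ℝ≥0) : ‖((r : ℝ) : ℂ)‖ = r := by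
  rw [Complex.norm_real, Real.norm_of_nonneg r.coe_nonneg]

theorem enorm_ofReal_nnreal (r : ℝ≥0) : ‖((r : ℝ) : ℂ)‖ₑ = r := by
  rw [← ofReal_norm, norm_ofReal_nnreal, ENNReal.ofReal_coe_nnreal]

section Attained

variable {A C D : Type u} [NonUnitalCStarAlgebra A] [NonUnitalCStarAlgebra C]
  [NonUnitalCStarAlgebra D] {E : Submodule ℂ A}

/-- The seminorm `v ↦ ‖(Id ⊗ v)(t)‖_max` on the maps `E → C` is the operator norm of a linear map.
-/
theorem exists_linearMap_maxTensorNorm (t : D ⊗[ℂ] E) :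
    ∃ (H : Type u) (_ : NormedAddCommGroup H) (_ : InnerProductSpace ℂ H) (_ : CompleteSpace H)
      (T : (E →ₗ[ℂ] C) →ₗ[ℂ] (H →L[ℂ] H)), ∀ v, maxTensorNorm (v.lTensor D t) = ‖T v‖ₑ := by
  obtain ⟨H, i1, i2, i3, π, σ, -, h⟩ := exists_rep_maxTensorNorm D C
  exact ⟨H, i1, i2, i3, prodRep π σ ∘ₗ LinearMap.applyₗ t ∘ₗ LinearMap.lTensorHom D, fun v => h _⟩

variable [FiniteDimensional ℂ E]

/-- A bound `r` of `z` on the unit ball `{v : E → C | ‖(Id ⊗ v)(t)‖_max ≤ 1}` persists on the maps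
`E → C**`. -/
theorem enorm_bidualPairing_le (t : D ⊗[ℂ] E) (z : E ⊗[ℂ] StrongDual ℂ C) {r : ℝ≥0}
    (h : ∀ v : E →ₗ[ℂ] C, maxTensorNorm (v.lTensor D t) ≤ 1 → (dualPairing z v).re ≤ r)
    (w : E →ₗ[ℂ] Bidual C) : ‖bidualPairing z w‖ₑ ≤ r * maxTensorNorm (w.lTensor D t) := by
  obtain ⟨H, i1, i2, i3, T, hT⟩ := exists_linearMap_maxTensorNorm (C := C) t
  have h1 : ∀ v, ‖dualPairing z v‖ ≤ r * ‖T v‖ :=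
    norm_le_mul_norm_of_re_le T (dualPairingₗ z) r.2 fun v hv => h v (by
      rw [hT, ← ofReal_norm]; exact ENNReal.ofReal_le_one.2 hv)
  rcases eq_or_ne r 0 with rfl | hr
  · have : z = 0 := eq_of_dualPairing_eq fun v => by
      have := h1 v
      rw [NNReal.coe_zero, zero_mul, norm_le_zero_iff] at this
      rw [this, dualPairing, bidualPairing_zero]
    simp [this, bidualPairing_zero]
  · obtain ⟨y, hy, hy'⟩ := exists_dualPairing_eq t ((((r : ℝ) : ℂ)⁻¹) • dualPairingₗ z) (fun v => by
      rw [hT, enorm_le_iff_norm_le, LinearMap.smul_apply, norm_smul, norm_inv, norm_ofReal_nnreal,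
        inv_mul_le_iff₀ (by positivity)]
      exact h1 v)
    have hz : z = ((r : ℝ) : ℂ) • y := eq_of_dualPairing_eq fun v => by
      have h2 := hy v
      rw [dualPairing] at h2 ⊢
      rw [dualPairing, bidualPairing_smul, ← h2]
      change _ = ((r : ℝ) : ℂ) * (((r : ℝ) : ℂ)⁻¹ * dualPairing z v)
      rw [mul_inv_cancel_left₀ (by simpa using hr)]
      rfl
    rw [hz, bidualPairing_smul, enorm_mul, enorm_ofReal_nnreal]
    exact mul_le_mul_right (hy' w) _

theorem isContractiveIntoBidual_of_attained {N : (E →ₗ[ℂ] C) → ℝ≥0∞}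
    {N'' : (E →ₗ[ℂ] Bidual C) → ℝ≥0∞} (t : D ⊗[ℂ] E)
    (h : ∀ v : E →ₗ[ℂ] C, N v ≤ maxTensorNorm (v.lTensor D t))
    (h'' : ∀ w : E →ₗ[ℂ] Bidual C, maxTensorNorm (w.lTensor D t) ≤ N'' w) :
    IsContractiveIntoBidual N N'' := by
  refine ⟨fun f ⟨M, hM⟩ => ?_, fun w => iSup₂_le fun z hz => ?_⟩
  · obtain ⟨z, hz⟩ : ∃ z : E ⊗[ℂ] StrongDual ℂ C, ∀ v, f v = dualPairing z v := by
      have hf : ∀ v, ‖f v‖ₑ ≤ M * maxTensorNorm (v.lTensor D t) := fun v =>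
        (hM v).trans (mul_le_mul_right (h v) _)
      obtain ⟨z, hz, -⟩ := exists_dualPairing_eq (((M : ℝ) : ℂ) • t) f (fun v => by
        obtain ⟨H, i1, i2, i3, π, σ, -, hmax⟩ := exists_rep_maxTensorNorm D C
        refine (hf v).trans ?_
        rw [hmax, hmax, map_smul, map_smul, enorm_smul, enorm_ofReal_nnreal])
      exact ⟨z, hz⟩
    exact ⟨z, hz, fun y hy => eq_of_dualPairing_eq fun v => by rw [← hz v, hy v]⟩
  · have := enorm_bidualPairing_le t z (r := 1) (fun v hv => by
      have h1 : ‖dualPairing z v‖ₑ ≤ 1 := (le_iSup₂_of_le v ((h v).trans hv) le_rfl).trans hz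
      have h2 : ‖dualPairing z v‖ ≤ 1 := by
        rw [← ofReal_norm] at h1
        exact ENNReal.ofReal_le_one.1 h1
      exact (Complex.re_le_norm _).trans h2) w
    rw [ENNReal.coe_one, one_mul] at this
    exact this.trans (h'' w)

/-- Otherwise a functional of finitely many coordinates `p.2 (v p.1)`, that is an element of `E ⊗
C*`, would separate `w` from the unit ball, contrary to `enorm_bidualPairing_le`. -/
theorem exists_dist_lt_of_maxTensorNorm_le_one (t : D ⊗[ℂ] E) (w : E →ₗ[ℂ] Bidual C)
    (hw : maxTensorNorm (w.lTensor D t) ≤ 1) (S : Finset (E × StrongDual ℂ C)) {ε : ℝ}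
    (hε : 0 < ε) :
    ∃ v : E →ₗ[ℂ] C, maxTensorNorm (v.lTensor D t) ≤ 1 ∧
      ∀ p ∈ S, dist (p.2 (v p.1)) (Bidual.eval (w p.1) p.2) < ε := by
  classical
  obtain ⟨H, i1, i2, i3, T, hT⟩ := exists_linearMap_maxTensorNorm (C := C) t
  have hT1 : ∀ v, maxTensorNorm (v.lTensor D t) ≤ 1 ↔ ‖T v‖ ≤ 1 := fun v => by
    rw [hT, ← ofReal_norm, ENNReal.ofReal_le_one]
  let L : (E →ₗ[ℂ] C) →ₗ[ℂ] (S → ℂ) :=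
    LinearMap.pi fun p => (p.1.2 : C →ₗ[ℂ] ℂ) ∘ₗ LinearMap.applyₗ p.1.1
  let x : S → ℂ := fun p => Bidual.eval (w p.1.1) p.1.2
  suffices hx : x ∈ closure (L '' {v | ‖T v‖ ≤ 1}) by
    obtain ⟨_, ⟨v, hv, rfl⟩, hd⟩ := Metric.mem_closure_iff.1 hx ε hε
    refine ⟨v, (hT1 v).2 hv, fun p hp => ?_⟩
    rw [dist_comm]
    exact (dist_le_pi_dist x (L v) ⟨p, hp⟩).trans_lt hd
  by_contra hx
  have hconv : Convex ℝ {v | ‖T v‖ ≤ 1} := by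
    intro v hv v' hv' a b ha hb hab
    have : T (a • v + b • v') = a • T v + b • T v' := by
      rw [← Complex.coe_smul, ← Complex.coe_smul, map_add, map_smul, map_smul, Complex.coe_smul,
        Complex.coe_smul]
    rw [Set.mem_ofPred_eq, this]
    refine (norm_add_le _ _).trans ?_
    rw [norm_smul, norm_smul, Real.norm_of_nonneg ha, Real.norm_of_nonneg hb, ← hab]
    exact add_le_add (mul_le_of_le_one_right ha hv) (mul_le_of_le_one_right hb hv')
  obtain ⟨f, r, hf, hfx⟩ := RCLike.geometric_hahn_banach_closed_point (𝕜 := ℂ)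
    ((hconv.is_linear_image (L.restrictScalars ℝ).isLinear).closure) isClosed_closure hx
  let z : E ⊗[ℂ] StrongDual ℂ C := ∑ p : S, f (Pi.single p 1) • (p.1.1 ⊗ₜ[ℂ] p.1.2)
  have hfs : ∀ y, f y = ∑ p, f (Pi.single p 1) * y p := fun y => by
    conv_lhs => rw [← Finset.univ_sum_single y]
    rw [map_sum]
    refine Finset.sum_congr rfl fun p _ => ?_
    rw [mul_comm, ← smul_eq_mul, ← map_smul, ← Pi.single_smul, smul_eq_mul, mul_one]
  have hzw : ∀ w', bidualPairing z w' = f fun p => Bidual.eval (w' p.1.1) p.1.2 := fun w' => by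
    rw [hfs, bidualPairing_sum]
    exact Finset.sum_congr rfl fun p _ => bidualPairing_smul _ _ _
  have hr : 0 < r := by
    have := hf (L 0) (subset_closure ⟨0, by simp, rfl⟩)
    simpa using this
  have h1 := enorm_bidualPairing_le t z (r := ⟨r, hr.le⟩) (fun v hv => by
    rw [dualPairing, hzw]
    exact (hf (L v) (subset_closure ⟨v, (hT1 v).1 hv, rfl⟩)).le) w
  have h2 : ‖bidualPairing z w‖ₑ ≤ ENNReal.ofReal r :=
    h1.trans ((mul_le_of_le_one_right zero_le hw).trans_eq
      (ENNReal.ofReal_eq_coe_nnreal hr.le).symm)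
  rw [← ofReal_norm, ENNReal.ofReal_le_ofReal_iff hr.le, hzw] at h2
  exact absurd (hfx.trans_le ((Complex.re_le_norm _).trans h2)) (lt_irrefl _)

theorem unitBallsWeakStarDense_of_attained {N : (E →ₗ[ℂ] C) → ℝ≥0∞}
    {N'' : (E →ₗ[ℂ] Bidual C) → ℝ≥0∞} (t : D ⊗[ℂ] E)
    (h : ∀ v : E →ₗ[ℂ] C, N v ≤ maxTensorNorm (v.lTensor D t))
    (h'' : ∀ w : E →ₗ[ℂ] Bidual C, maxTensorNorm (w.lTensor D t) ≤ N'' w) :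
    UnitBallsWeakStarDense N N'' := by
  classical
  intro w hw
  -- the net is indexed by finite sets of coordinates together with an accuracy `1 / (n + 1)`
  choose v hv hv' using fun i : Finset (E × StrongDual ℂ C) × ℕ =>
    exists_dist_lt_of_maxTensorNorm_le_one t w ((h'' w).trans hw) i.1
      (Nat.one_div_pos_of_nat (α := ℝ) (n := i.2))
  refine ⟨Finset (E × StrongDual ℂ C) × ℕ, inferInstance, inferInstance, inferInstance, v,
    fun i => (h _).trans (hv i), fun e φ => Metric.tendsto_atTop.2 fun ε hε => ?_⟩
  obtain ⟨n, hn⟩ := exists_nat_one_div_lt hε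
  refine ⟨({(e, φ)}, n), fun i hi => ?_⟩
  refine (hv' i (e, φ) (hi.1 (by simp))).trans (lt_of_le_of_lt ?_ hn)
  exact Nat.one_div_le_one_div hi.2

end Attained

/-! ### Existence of a norming tensor -/

section Gluing

variable {D D' A B : Type u} [NonUnitalCStarAlgebra D] [NonUnitalCStarAlgebra D']
  [NonUnitalCStarAlgebra A]

theorem maxTensorNorm_rTensor_le [NonUnitalRing B] [Module ℂ B] [Star B] (p : D →⋆ₙₐ[ℂ] D')
    (t : D ⊗[ℂ] B) : maxTensorNorm ((p : D →ₗ[ℂ] D').rTensor B t) ≤ maxTensorNorm t := by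
  conv_lhs => unfold maxTensorNorm
  simp only [iSup_le_iff]
  intro H _ _ _ π σ hc
  have h : prodRep π σ ((p : D →ₗ[ℂ] D').rTensor B t) = prodRep (π.comp p) σ t := by
    induction t with
    | zero => simp
    | tmul d b => rfl
    | add x y hx hy => simp only [map_add, hx, hy]
  rw [h]
  exact enorm_prodRep_le_maxTensorNorm (π.comp p) σ (fun d b => hc (p d) b) t

theorem maxTensorNorm_zero [NonUnitalRing B] [Module ℂ B] [Star B] :
    maxTensorNorm (0 : D ⊗[ℂ] B) = 0 := by
  simp [maxTensorNorm]

theorem minTensorNorm_zero : minTensorNorm (0 : D ⊗[ℂ] A) = 0 := by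
  simpa using minTensorNorm_tmul_le (0 : D) (0 : A)

theorem sum_sliceMap_tmul {V ι : Type*} [AddCommGroup V] [Module ℂ V] [Fintype ι]
    (b : Module.Basis ι ℂ V) (t : D ⊗[ℂ] V) : ∑ k, sliceMap D (b.coord k) t ⊗ₜ[ℂ] b k = t := by
  induction t with
  | zero => simp
  | tmul d v =>
    simp only [sliceMap_tmul, TensorProduct.smul_tmul, ← TensorProduct.tmul_sum,
      Module.Basis.coord_apply, b.sum_repr]
  | add x y hx hy =>
    simp only [map_add, TensorProduct.add_tmul, Finset.sum_add_distrib, hx, hy]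

/-- If bounded families in the `M i` lift to `D`, then elements of the unit balls of `M i ⊗_min E`
lift to one element of the unit ball of `D ⊗_min E`. -/
theorem exists_tensor_of_forall_minTensorNorm_le_one {E : Submodule ℂ A} [FiniteDimensional ℂ E]
    {I : Type*} {M : I → Type u} [∀ i, NonUnitalCStarAlgebra (M i)] (p : ∀ i, D →⋆ₙₐ[ℂ] M i)
    (hp : ∀ d, (∀ i, p i d = 0) → d = 0)
    (hp' : ∀ (x : ∀ i, M i) (c : ℝ), (∀ i, ‖x i‖ ≤ c) → ∃ d, ∀ i, p i d = x i)
    (t : ∀ i, M i ⊗[ℂ] E) (ht : ∀ i, minTensorNorm (E.subtype.lTensor (M i) (t i)) ≤ 1) :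
    ∃ s : D ⊗[ℂ] E, minTensorNorm (E.subtype.lTensor D s) ≤ 1 ∧
      ∀ i, (p i : D →ₗ[ℂ] M i).rTensor E s = t i := by
  let b := Module.finBasis ℂ E
  have hd : ∀ k, ∃ d : D, ∀ i, p i d = sliceMap (M i) (b.coord k) (t i) := fun k => by
    obtain ⟨c, hc⟩ := exists_enorm_sliceMap_le E (b.coord k)
    refine hp' _ c fun i => ?_
    have := (hc (M i) (t i)).trans (mul_le_mul_right (ht i) _)
    rw [mul_one] at this
    exact enorm_le_coe.1 this
  choose d hd using hd
  have hs : ∀ i, (p i : D →ₗ[ℂ] M i).rTensor E (∑ k, d k ⊗ₜ[ℂ] b k) = t i := fun i => by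
    rw [map_sum, ← sum_sliceMap_tmul b (t i)]
    exact Finset.sum_congr rfl fun k _ => by rw [← hd]; rfl
  refine ⟨∑ k, d k ⊗ₜ[ℂ] b k, ?_, hs⟩
  rw [← ENNReal.coe_one]
  refine minTensorNorm_le_of_forall_le p hp _ fun i => ?_
  rw [← LinearMap.comp_apply, LinearMap.rTensor_comp_lTensor, ← LinearMap.lTensor_comp_rTensor,
    LinearMap.comp_apply, hs, ENNReal.coe_one]
  exact ht i

theorem maxTensorNorm_lTensor_rTensor_le [NonUnitalRing B] [Module ℂ B] [Star B]
    {E : Submodule ℂ A} (w : E →ₗ[ℂ] B) (p : D →⋆ₙₐ[ℂ] D') (t : D ⊗[ℂ] E) :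
    maxTensorNorm (w.lTensor D' ((p : D →ₗ[ℂ] D').rTensor E t)) ≤
      maxTensorNorm (w.lTensor D t) := by
  rw [← LinearMap.comp_apply, LinearMap.lTensor_comp_rTensor, ← LinearMap.rTensor_comp_lTensor,
    LinearMap.comp_apply]
  exact maxTensorNorm_rTensor_le p _

end Gluing

section Evaluation

variable {I : Type*} {M : I → Type*} [∀ i, NonUnitalCStarAlgebra (M i)]

/-- Evaluation at `i` on an `ℓ∞`-sum of C*-algebras. -/
noncomputable def lpEval (i : I) : lp M ∞ →⋆ₙₐ[ℂ] M i where
  toFun f := f i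
  map_smul' _ _ := rfl
  map_zero' := rfl
  map_add' _ _ := rfl
  map_mul' _ _ := rfl
  map_star' _ := rfl

end Evaluation

section Attainment

variable {A C : Type u} [NonUnitalCStarAlgebra A] [NonUnitalCStarAlgebra C] {E : Submodule ℂ A}

/-- Continuity of `v ↦ ‖(Id ⊗ v)(t)‖_max`, a map `v` being given by its values on a basis of `E`. -/
theorem continuous_maxTensorNorm_constr {D : Type u} [NonUnitalCStarAlgebra D] {ι : Type*}
    [Fintype ι] (b : Module.Basis ι ℂ E) (t : D ⊗[ℂ] E) :
    Continuous fun x : ι → C => maxTensorNorm ((b.constr ℂ x).lTensor D t) := by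
  obtain ⟨H, i1, i2, i3, π, σ, -, h⟩ := exists_rep_maxTensorNorm D C
  have hσ : Continuous σ :=
    AddMonoidHomClass.continuous_of_bound σ 1 fun c => by
      simpa using NonUnitalStarAlgHom.norm_apply_le σ c
  have he : ∀ x : ι → C, prodRep π σ ((b.constr ℂ x).lTensor D t) =
      ∑ k, π (sliceMap D (b.coord k) t) * σ (x k) := fun x => by
    conv_lhs => rw [← sum_sliceMap_tmul b t]
    rw [map_sum, map_sum]
    exact Finset.sum_congr rfl fun k _ => by
      rw [LinearMap.lTensor_tmul, prodRep_tmul, b.constr_basis]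
  simp only [h, he]
  fun_prop

variable [FiniteDimensional ℂ E]

/-- If `𝒟` is empty, the norms vanish and `t = 0` is norming for any algebra, here `A`. -/
theorem exists_attaining_mMClassNorm {𝒟 : CStarClass.{u}} (h𝒟 : 𝒟.StableUnderSums) :
    ∃ (D : Type u) (_ : NonUnitalCStarAlgebra D) (t : D ⊗[ℂ] E),
      (∀ v : E →ₗ[ℂ] C, mMClassNorm 𝒟 v ≤ maxTensorNorm (v.lTensor D t)) ∧
      ∀ w : E →ₗ[ℂ] Bidual C, maxTensorNorm (w.lTensor D t) ≤ mMClassNorm 𝒟 w := by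
  have h : ∀ j : {p : (E →ₗ[ℂ] C) × ℝ≥0∞ // p.2 < mMClassNorm 𝒟 p.1},
      ∃ (D : Type u) (_ : NonUnitalCStarAlgebra D) (_ : 𝒟 D) (t : D ⊗[ℂ] E),
        minTensorNorm (E.subtype.lTensor D t) ≤ 1 ∧ j.1.2 < maxTensorNorm (j.1.1.lTensor D t) := by
    rintro ⟨⟨v, r⟩, hr⟩
    simpa only [mMClassNorm, minMaxNorm, lt_iSup_iff, exists_prop] using hr
  choose M i1 hM t ht hr using h
  rcases isEmpty_or_nonempty {p : (E →ₗ[ℂ] C) × ℝ≥0∞ // p.2 < mMClassNorm 𝒟 p.1} with hJ | hJ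
  · refine ⟨A, inferInstance, 0, fun v => le_of_forall_lt fun r hr => hJ.elim ⟨(v, r), hr⟩,
      fun w => ?_⟩
    rw [map_zero, maxTensorNorm_zero]
    exact zero_le
  · obtain ⟨s, hs, hs'⟩ := exists_tensor_of_forall_minTensorNorm_le_one (E := E) (D := lp M ∞) lpEval
      (fun d hd => lp.ext (funext hd))
      (fun x c hx => ⟨⟨x, memℓp_infty ⟨c, by rintro _ ⟨i, rfl⟩; exact hx i⟩⟩, fun i => rfl⟩) t ht
    refine ⟨lp M ∞, inferInstance, s, fun v => le_of_forall_lt fun r hlt => ?_, fun w => ?_⟩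
    · refine (hr ⟨(v, r), hlt⟩).trans_le ?_
      rw [← hs']
      exact maxTensorNorm_lTensor_rTensor_le v (lpEval _) s
    · exact (maxTensorNorm_le_minMaxNorm w hs).trans
        (le_iSup_of_le (lp M ∞) <| le_iSup_of_le _ <| le_iSup_of_le (h𝒟 _ M hM) le_rfl)

/-- The hypotheses say that `D` is isomorphic to the algebra of bounded sequences in `D`, with
coordinate maps `p`. -/
theorem exists_attaining_minMaxNorm {D : Type u} [NonUnitalCStarAlgebra D]
    [TopologicalSpace.SeparableSpace C] (p : ℕ → D →⋆ₙₐ[ℂ] D)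
    (hp : ∀ d, (∀ i, p i d = 0) → d = 0)
    (hp' : ∀ (x : ℕ → D) (c : ℝ), (∀ i, ‖x i‖ ≤ c) → ∃ d, ∀ i, p i d = x i) :
    ∃ t : D ⊗[ℂ] E, minTensorNorm (E.subtype.lTensor D t) ≤ 1 ∧
      ∀ v : E →ₗ[ℂ] C, minMaxNorm D v ≤ maxTensorNorm (v.lTensor D t) := by
  let b := Module.finBasis ℂ E
  -- for each map `v m` of a countable dense family, tensors `t m q` approximating its norm
  let v : ℕ → E →ₗ[ℂ] C := fun m => b.constr ℂ (TopologicalSpace.denseSeq _ m)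
  let U : Set (D ⊗[ℂ] E) := {t | minTensorNorm (E.subtype.lTensor D t) ≤ 1}
  have hU : U.Nonempty := ⟨0, by simp [U, minTensorNorm_zero]⟩
  have h : ∀ m, ∃ t : ℕ → D ⊗[ℂ] E, (∀ q, t q ∈ U) ∧
      Tendsto (fun q => maxTensorNorm ((v m).lTensor D (t q))) atTop (𝓝 (minMaxNorm D (v m))) := by
    intro m
    obtain ⟨u, -, hu, hu'⟩ := exists_seq_tendsto_sSup
      (hU.image fun t => maxTensorNorm ((v m).lTensor D t)) (OrderTop.bddAbove _)
    choose t ht ht' using hu'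
    rw [sSup_image] at hu
    refine ⟨t, ht, ?_⟩
    simp only [ht']
    exact hu
  choose t ht htlim using h
  obtain ⟨s, hs, hs'⟩ := exists_tensor_of_forall_minTensorNorm_le_one (E := E) p hp hp'
    (fun n => t n.unpair.1 n.unpair.2) fun n => ht _ _
  refine ⟨s, hs, fun v' => iSup₂_le fun t' ht' => ?_⟩
  have key : ∀ x, maxTensorNorm ((b.constr ℂ x).lTensor D t') ≤
      maxTensorNorm ((b.constr ℂ x : E →ₗ[ℂ] C).lTensor D s) := fun x =>
    (TopologicalSpace.denseRange_denseSeq _).induction_on x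
      (isClosed_le (continuous_maxTensorNorm_constr b t') (continuous_maxTensorNorm_constr b s))
      fun m => (maxTensorNorm_le_minMaxNorm (v m) ht').trans <|
        le_of_tendsto' (htlim m) fun q => by
          have := hs' (Nat.pair m q)
          rw [Nat.unpair_pair] at this
          rw [← this]
          exact maxTensorNorm_lTensor_rTensor_le (v m) (p _) s
  simpa using key ((b.constr ℂ).symm v')

/-- The algebra of bounded sequences in `B` is its own sequence algebra: the `n`-th coordinate of
`f` is `m ↦ f (n, m)`, for a bijection of `ℕ × ℕ` with `ℕ`. -/
theorem exists_attaining_minMaxNorm_lp (B : Type) [NonUnitalCStarAlgebra B]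
    [TopologicalSpace.SeparableSpace C] :
    ∃ t : lp (fun _ : ULift.{u} ℕ => B) ∞ ⊗[ℂ] E,
      minTensorNorm (E.subtype.lTensor (lp (fun _ : ULift.{u} ℕ => B) ∞) t) ≤ 1 ∧
      ∀ v : E →ₗ[ℂ] C, minMaxNorm (lp (fun _ : ULift.{u} ℕ => B) ∞) v ≤
        maxTensorNorm (v.lTensor (lp (fun _ : ULift.{u} ℕ => B) ∞) t) := by
  let p : ℕ → lp (fun _ : ULift.{u} ℕ => B) ∞ →⋆ₙₐ[ℂ] lp (fun _ : ULift.{u} ℕ => B) ∞ := fun n =>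
    { toFun := fun f => ⟨fun m => f ⟨Nat.pair n m.down⟩, memℓp_infty ⟨‖f‖, by
        rintro _ ⟨m, rfl⟩
        exact lp.norm_apply_le_norm (by simp) f _⟩⟩
      map_smul' := fun _ _ => rfl
      map_zero' := rfl
      map_add' := fun _ _ => rfl
      map_mul' := fun _ _ => rfl
      map_star' := fun _ => rfl }
  refine exists_attaining_minMaxNorm p (fun d hd => lp.ext (funext fun m => ?_)) fun x c hx => ?_
  · have h := congrArg (fun f => f ⟨m.down.unpair.2⟩) (hd m.down.unpair.1)
    change d ⟨Nat.pair m.down.unpair.1 m.down.unpair.2⟩ = 0 at h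
    rwa [Nat.pair_unpair] at h
  · refine ⟨⟨fun m => x m.down.unpair.1 ⟨m.down.unpair.2⟩, memℓp_infty ⟨c, ?_⟩⟩,
      fun n => lp.ext (funext fun m => ?_)⟩
    · rintro _ ⟨m, rfl⟩
      exact (lp.norm_apply_le_norm (by simp) _ _).trans (hx _)
    · change x (Nat.pair n m.down).unpair.1 ⟨(Nat.pair n m.down).unpair.2⟩ = x n m
      rw [Nat.unpair_pair]

end Attainment

theorem nontrivial_ellInftyFullFree : Nontrivial EllInftyFullFree.{u} := by
  have h1 : universalUnitary 1 ≠ 0 := fun h => by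
    have h2 : (1 : EllTwo →L[ℂ] EllTwo) = 0 :=
      congrArg (fun f : lp (fun _ : FreeGroupRep => EllTwo →L[ℂ] EllTwo) ∞ => f 1) h
    have h3 := congrArg (fun T => T (lp.single 2 0 1) 0) h2
    simp at h3
  let a : FullFreeGroupCStar := ⟨universalUnitary 1,
    NonUnitalStarSubalgebra.le_topologicalClosure _
      (NonUnitalStarAlgebra.subset_adjoin ℂ _ ⟨1, rfl⟩)⟩
  classical
  refine ⟨lp.single ∞ ⟨0⟩ a, 0, fun h => h1 ?_⟩
  have h2 := congrArg (fun f => f ⟨0⟩) h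
  simp at h2
  exact congrArg Subtype.val h2

theorem mainTheorem7 {A C : Type u} [NonUnitalCStarAlgebra A] [NonUnitalCStarAlgebra C]
    (E : Submodule ℂ A) [FiniteDimensional ℂ E] :
    (∀ 𝒟 : CStarClass.{u}, 𝒟.StableUnderSums →
      IsContractiveIntoBidual
        (fun v : E →ₗ[ℂ] C => mMClassNorm 𝒟 v) (fun w : E →ₗ[ℂ] Bidual C => mMClassNorm 𝒟 w) ∧
      (𝒟.HasNonzero → ∀ z : E ⊗[ℂ] StrongDual ℂ C,
        IsBoundedFunctional (fun v : E →ₗ[ℂ] C => mMClassNorm 𝒟 v) (dualPairing z)) ∧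
      UnitBallsWeakStarDense
        (fun v : E →ₗ[ℂ] C => mMClassNorm 𝒟 v) (fun w : E →ₗ[ℂ] Bidual C => mMClassNorm 𝒟 w)) ∧
    (TopologicalSpace.SeparableSpace C →
      IsContractiveIntoBidual
        (fun v : E →ₗ[ℂ] C => mMNorm v) (fun w : E →ₗ[ℂ] Bidual C => mMNorm w) ∧
      (∀ z : E ⊗[ℂ] StrongDual ℂ C,
        IsBoundedFunctional (fun v : E →ₗ[ℂ] C => mMNorm v) (dualPairing z)) ∧
      UnitBallsWeakStarDense
        (fun v : E →ₗ[ℂ] C => mMNorm v) (fun w : E →ₗ[ℂ] Bidual C => mMNorm w)) := by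
  refine ⟨fun 𝒟 h𝒟 => ?_, fun hC => ?_⟩
  · obtain ⟨D, i1, t, ht, ht'⟩ := exists_attaining_mMClassNorm (C := C) (E := E) h𝒟
    refine ⟨isContractiveIntoBidual_of_attained t ht ht', ?_,
      unitBallsWeakStarDense_of_attained t ht ht'⟩
    rintro ⟨D', i2, hD', i3⟩ z
    refine isBoundedFunctional_dualPairing (fun e => ?_) z
    obtain ⟨M, hM⟩ := exists_enorm_apply_le_minMaxNorm (C := C) D' e
    have hle : ∀ v : E →ₗ[ℂ] C, minMaxNorm D' v ≤ mMClassNorm 𝒟 v := fun v =>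
      le_iSup_of_le D' <| le_iSup_of_le i2 <| le_iSup (fun _ : 𝒟 D' => minMaxNorm D' v) hD'
    exact ⟨M, fun v => (hM v).trans (mul_le_mul_right (hle v) _)⟩
  · obtain ⟨t, ht, ht'⟩ := exists_attaining_minMaxNorm_lp (C := C) (E := E) FullFreeGroupCStar
    have ht'' : ∀ w : E →ₗ[ℂ] Bidual C,
        maxTensorNorm (w.lTensor EllInftyFullFree.{u} t) ≤ mMNorm w :=
      fun w => maxTensorNorm_le_minMaxNorm w ht
    refine ⟨isContractiveIntoBidual_of_attained t ht' ht'', fun z => ?_,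
      unitBallsWeakStarDense_of_attained t ht' ht''⟩
    have := nontrivial_ellInftyFullFree.{u}
    exact isBoundedFunctional_dualPairing
      (fun e => exists_enorm_apply_le_minMaxNorm EllInftyFullFree.{u} e) z
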